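/- Let $X$ be a semigroup. An upfamily on $X$ is a family $\mathcal F$ of non-empty subsets of $X$ such that $F\in\mathcal F$ and $F\subset E\subset X$ imply $E\in\mathcal F$. The set $\upsilon(X)$ of all upfamilies on $X$ is a semigroup under $$\mathcal A*\mathcal B=\Big\{S\subset X:\ \exists A\in\mathcal A\ \ \exists (B_a)_{a\in A}\in\mathcal B^{A}\ \text{ with }\ \bigcup_{a\in A}aB_a\subset S\Big\}.$$ An upfamily is linked if any two of its members intersect; a linked upfamily is maximal linked if no other linked upfamily contains it. Let $N_2(X)$ be the subsemigroup of $\upsilon(X)$ consisting of all linked upfamilies, and let the superextension $\lambda(X)\subset N_2(X)$ be the subsemigroup of all maximal linked upfamilies. A semigroup $S$ is inverse if for every $x\in S$ there is a unique $y\in S$ with $xyx=x$ and $yxy=y$; it is Clifford if it is a union of groups, and sub-Clifford if it is a union of cancellative semigroups. A subsemigroup $S$ of a semigroup $T$ is regular in $T$ if $x\in xTx$ for each $x\in S$. Let $C_n$ be the cyclic group of order $n$, and let $L_n=\{0,\dots,n-1\}$ with the operation of minimum (so $L_0$ is the empty semigroup). For semigroups $Y,Z$ let $Y\sqcup Z$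 be their disjoint union with the operation that extends those of $Y$ and $Z$ and satisfies $yz=zy=y$ for $y\in Y$, $z\in Z$. **Theorem 1.1.** For a semigroup $X$ (possibly empty) the following conditions are equivalent: 1. $\lambda(X)$ is a commutative Clifford semigroup; 2. $\lambda(X)$ is an inverse semigroup; 3. the idempotents of $\lambda(X)$ commute, and $\lambda(X)$ is sub-Clifford or regular in $N_2(X)$; 4. $X$ is a finite commutative Clifford semigroup isomorphic to one of the semigroups $C_2$, $C_3$, $C_4$, $C_2\times C_2$, $L_2\times C_2$, $L_1\sqcup C_2$, or to $L_n$ or $C_2\sqcup L_n$ for some integer $n\ge 0$. -/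

import Mathlib

/-! ### Classes of semigroups -/

/-- A semigroup is inverse if every element `x` has a unique `y` with `xyx = x` and `yxy = y`. -/
def IsInverseSemigroup (S : Type*) [Semigroup S] : Prop :=
  ∀ x : S, ∃! y : S, x * y * x = x ∧ y * x * y = y

/-- A subsemigroup that is a group under the inherited operation. -/
def IsGroupSubsemigroup {S : Type*} [Semigroup S] (G : Subsemigroup S) : Prop :=
  ∃ e ∈ G, (∀ x ∈ G, e * x = x ∧ x * e = x) ∧ ∀ x ∈ G, ∃ y ∈ G, x * y = e ∧ y * x = e

/-- A semigroup is Clifford if it is a union of groups. -/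
def IsCliffordSemigroup (S : Type*) [Semigroup S] : Prop :=
  ∀ x : S, ∃ G : Subsemigroup S, x ∈ G ∧ IsGroupSubsemigroup G

/-- A semigroup is sub-Clifford if it is a union of cancellative semigroups. -/
def IsSubCliffordSemigroup (S : Type*) [Semigroup S] : Prop :=
  ∀ x : S, ∃ T : Subsemigroup S, x ∈ T ∧ IsCancelMul T

/-- All idempotents of the semigroup commute with each other. -/
def IdempotentsCommute (S : Type*) [Semigroup S] : Prop :=
  ∀ e f : S, e * e = e → f * f = f → e * f = f * e

/-- For subsemigroups `S`, `T` of a common semigroup: every `x ∈ S` is regular in `T`, i.e.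
`x ∈ x T x`. -/
def IsRegularIn {U : Type*} [Semigroup U] (S T : Subsemigroup U) : Prop :=
  ∀ x ∈ S, ∃ y ∈ T, x * y * x = x

/-! ### Upfamilies -/

/-- An upfamily on `X`: a family of non-empty subsets of `X` closed under taking supersets. -/
@[ext]
structure Upfamily (X : Type*) where
  /-- the members of the family -/
  sets : Set (Set X)
  nonempty_of_mem : ∀ A ∈ sets, A.Nonempty
  mem_of_superset : ∀ A ∈ sets, ∀ B : Set X, A ⊆ B → B ∈ sets

namespace Upfamily

variable {X : Type*}

/-- The product of two upfamilies, generated by the sets `⋃ a ∈ A, a * B a` with `A ∈ F` and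
`B a ∈ G` for all `a ∈ A`. -/
instance [Mul X] : Mul (Upfamily X) where
  mul F G :=
    { sets := {S | ∃ A ∈ F.sets, ∃ B : X → Set X,
        (∀ a ∈ A, B a ∈ G.sets) ∧ (⋃ a ∈ A, (fun b => a * b) '' B a) ⊆ S}
      nonempty_of_mem := by
        rintro S ⟨A, hA, B, hB, hS⟩
        obtain ⟨a, ha⟩ := F.nonempty_of_mem A hA
        obtain ⟨b, hb⟩ := G.nonempty_of_mem _ (hB a ha)
        exact ⟨a * b, hS (Set.mem_biUnion ha ⟨b, hb, rfl⟩)⟩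
      mem_of_superset := by
        rintro S ⟨A, hA, B, hB, hS⟩ T hST
        exact ⟨A, hA, B, hB, hS.trans hST⟩ }

theorem mem_mul [Mul X] (F G : Upfamily X) (S : Set X) :
    S ∈ (F * G).sets ↔ {a | {b | a * b ∈ S} ∈ G.sets} ∈ F.sets := by
  constructor
  · rintro ⟨A, hA, B, hB, hS⟩
    refine F.mem_of_superset A hA _ fun a ha => ?_
    exact G.mem_of_superset _ (hB a ha) _ fun b hb => hS (Set.mem_biUnion ha ⟨b, hb, rfl⟩)
  · intro h
    refine ⟨_, h, fun a => {b | a * b ∈ S}, fun a ha => ha, ?_⟩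
    intro x hx
    simp only [Set.mem_iUnion] at hx
    obtain ⟨a, _, b, hb, rfl⟩ := hx
    exact hb

/-- The semigroup of all upfamilies on a semigroup `X`. -/
instance [Semigroup X] : Semigroup (Upfamily X) where
  mul_assoc F G H := by
    ext S
    simp only [mem_mul, Set.mem_ofPred_eq, mul_assoc]

/-- An upfamily is linked if any two of its members intersect. -/
def IsLinked (F : Upfamily X) : Prop :=
  ∀ A ∈ F.sets, ∀ B ∈ F.sets, (A ∩ B).Nonempty

/-- A linked upfamily is maximal linked if it equals every linked upfamily containing it. -/
def IsMaximalLinked (F : Upfamily X) : Prop :=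
  F.IsLinked ∧ ∀ G : Upfamily X, G.IsLinked → F.sets ⊆ G.sets → F = G

theorem IsLinked.mul [Mul X] {F G : Upfamily X} (hF : F.IsLinked) (hG : G.IsLinked) :
    (F * G).IsLinked := by
  intro A hA B hB
  rw [mem_mul] at hA hB
  obtain ⟨a, ha, ha'⟩ := hF _ hA _ hB
  obtain ⟨b, hb, hb'⟩ := hG _ ha _ ha'
  exact ⟨a * b, hb, hb'⟩

/-- A maximal linked upfamily contains each non-empty set that meets all its members. -/
theorem IsMaximalLinked.mem_of_forall {F : Upfamily X} (hF : F.IsMaximalLinked) {S : Set X}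
    (hS : S.Nonempty) (h : ∀ A ∈ F.sets, (S ∩ A).Nonempty) : S ∈ F.sets := by
  let G : Upfamily X :=
    { sets := F.sets ∪ {T | S ⊆ T}
      nonempty_of_mem := by
        rintro A (hA | hA)
        · exact F.nonempty_of_mem A hA
        · exact hS.mono hA
      mem_of_superset := by
        rintro A (hA | hA) B hAB
        · exact Or.inl (F.mem_of_superset A hA B hAB)
        · exact Or.inr (Set.Subset.trans hA hAB) }
  have hG : G.IsLinked := by
    rintro A (hA | hA) B (hB | hB)
    · exact hF.1 A hA B hB
    · obtain ⟨x, hx, hx'⟩ := h A hA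
      exact ⟨x, hx', hB hx⟩
    · obtain ⟨x, hx, hx'⟩ := h B hB
      exact ⟨x, hA hx, hx'⟩
    · obtain ⟨x, hx⟩ := hS
      exact ⟨x, hA hx, hB hx⟩
  rw [hF.2 G hG Set.subset_union_left]
  exact Or.inr Set.Subset.rfl

theorem IsMaximalLinked.mem_or_compl_mem [Nonempty X] {F : Upfamily X}
    (hF : F.IsMaximalLinked) (S : Set X) : S ∈ F.sets ∨ Sᶜ ∈ F.sets := by
  by_contra! hcon
  obtain ⟨h1, h2⟩ := hcon
  have key : ∀ T : Set X, T ∉ F.sets → T.Nonempty → ∃ A ∈ F.sets, A ⊆ Tᶜ := by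
    intro T hT hne
    by_contra! hno
    refine hT (hF.mem_of_forall hne fun A hA => ?_)
    by_contra he
    exact hno A hA fun x hx hxT => he ⟨x, hxT, hx⟩
  rcases S.eq_empty_or_nonempty with rfl | hS
  · refine h2 (hF.mem_of_forall (by simp) fun A hA => ?_)
    simpa using F.nonempty_of_mem A hA
  · obtain ⟨A, hA, hAS⟩ := key S h1 hS
    exact h2 (F.mem_of_superset A hA _ hAS)

theorem IsMaximalLinked.mul [Mul X] {F G : Upfamily X} (hF : F.IsMaximalLinked)
    (hG : G.IsMaximalLinked) : (F * G).IsMaximalLinked := by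
  refine ⟨hF.1.mul hG.1, fun H hH hle => ?_⟩
  apply Upfamily.ext
  refine Set.Subset.antisymm hle fun S hS => ?_
  have : Nonempty X := ⟨(H.nonempty_of_mem S hS).some⟩
  by_contra hno
  rw [mem_mul] at hno
  have h1 := (hF.mem_or_compl_mem _).resolve_left hno
  have h2 : Sᶜ ∈ (F * G).sets := by
    rw [mem_mul]
    refine F.mem_of_superset _ h1 _ fun a ha => ?_
    exact (hG.mem_or_compl_mem {b | a * b ∈ S}).resolve_left ha
  obtain ⟨x, hx, hx'⟩ := hH _ hS _ (hle h2)
  exact hx' hx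

end Upfamily

/-- The semigroup `N₂(X)` of linked upfamilies on `X`. -/
def linkedUpfamilies (X : Type*) [Semigroup X] : Subsemigroup (Upfamily X) where
  carrier := {F | F.IsLinked}
  mul_mem' hF hG := Upfamily.IsLinked.mul hF hG

/-- The superextension `λ(X)`: the semigroup of maximal linked upfamilies on `X`. -/
def superextension (X : Type*) [Semigroup X] : Subsemigroup (Upfamily X) where
  carrier := {F | F.IsMaximalLinked}
  mul_mem' hF hG := Upfamily.IsMaximalLinked.mul hF hG

/-! ### The exceptional semigroups -/

/-- The cyclic group of order `n` (for `n ≥ 1`), written multiplicatively. -/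
abbrev CyclicGrp (n : ℕ) : Type := Multiplicative (ZMod n)

/-- The linear semilattice `{0, …, n - 1}` with the operation of minimum; empty for `n = 0`. -/
def LinSemilattice (n : ℕ) : Type := Fin n

instance (n : ℕ) : Semigroup (LinSemilattice n) where
  mul x y := (min (α := Fin n) x y : Fin n)
  mul_assoc x y z := min_assoc (α := Fin n) x y z

/-- The disjoint ordered union `X ⊔ Y` of two semigroups: the disjoint union, in which
`x * y = y * x = x` for `x ∈ X` and `y ∈ Y`. -/
def OrderedUnion (X Y : Type*) : Type _ := X ⊕ Y

namespace OrderedUnion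

variable {X Y : Type*}

/-- The operation of the disjoint ordered union. -/
def mul [Mul X] [Mul Y] : X ⊕ Y → X ⊕ Y → X ⊕ Y
  | .inl x, .inl y => .inl (x * y)
  | .inl x, .inr _ => .inl x
  | .inr _, .inl y => .inl y
  | .inr x, .inr y => .inr (x * y)

instance [Semigroup X] [Semigroup Y] : Semigroup (OrderedUnion X Y) where
  mul := mul
  mul_assoc a b c := by
    change mul (mul a b) c = mul a (mul b c)
    rcases a with a | a <;> rcases b with b | b <;> rcases c with c | c <;>
      simp [mul, mul_assoc]

end OrderedUnion

namespace Upfamily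

/-! ### Maximal linked upfamilies: principal families, boxes, images, ultrafilters -/

variable {X Y : Type*}

theorem isMaximalLinked_of_forall {F : Upfamily X} (hF : F.IsLinked)
    (h : ∀ S : Set X, S ∈ F.sets ∨ Sᶜ ∈ F.sets) : F.IsMaximalLinked := by
  refine ⟨hF, fun G hG hle => Upfamily.ext (hle.antisymm fun S hS => ?_)⟩
  refine (h S).resolve_right fun hc => ?_
  obtain ⟨x, hx, hx'⟩ := hG _ hS _ (hle hc)
  exact hx' hx

theorem IsMaximalLinked.compl_mem_iff [Nonempty X] {F : Upfamily X} (hF : F.IsMaximalLinked)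
    (S : Set X) : Sᶜ ∈ F.sets ↔ S ∉ F.sets := by
  refine ⟨fun h h' => ?_, fun h => (hF.mem_or_compl_mem S).resolve_left h⟩
  obtain ⟨x, hx, hx'⟩ := hF.1 _ h _ h'
  exact hx hx'

/-- Two maximal linked upfamilies are equal as soon as no set separates them. -/
theorem IsMaximalLinked.eq_of_disjoint [Nonempty X] {F G : Upfamily X} (hF : F.IsMaximalLinked)
    (hG : G.IsMaximalLinked) (h : ∀ S, S ∈ F.sets → Sᶜ ∈ G.sets → False) : F = G :=
  hF.2 G hG.1 fun S hS => by
    by_contra hn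
    exact h S hS ((hG.compl_mem_iff S).2 hn)

/-- The upfamily of all sets containing a given point. -/
def principal (x : X) : Upfamily X where
  sets := {A | x ∈ A}
  nonempty_of_mem _ hA := ⟨x, hA⟩
  mem_of_superset _ hA _ hAB := hAB hA

theorem mem_principal {x : X} {A : Set X} : A ∈ (principal x).sets ↔ x ∈ A := Iff.rfl

theorem isMaximalLinked_principal (x : X) : (principal x).IsMaximalLinked :=
  isMaximalLinked_of_forall (fun _ hA _ hB => ⟨x, hA, hB⟩) fun S => by
    simp only [mem_principal, Set.mem_compl_iff]; exact em _

theorem principal_injective : Function.Injective (principal : X → Upfamily X) := by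
  intro x y h
  have : ({x} : Set X) ∈ (principal y).sets := h ▸ (rfl : x ∈ ({x} : Set X))
  exact (Set.mem_singleton_iff.1 this).symm

theorem principal_mul [Mul X] (x y : X) : principal x * principal y = principal (x * y) := by
  ext S; simp [mem_mul, mem_principal]

theorem IsMaximalLinked.eq_principal {F : Upfamily X} (hF : F.IsMaximalLinked) {x : X}
    (hx : {x} ∈ F.sets) : F = principal x := by
  refine hF.2 _ (isMaximalLinked_principal x).1 fun S hS => ?_
  obtain ⟨y, hy, rfl⟩ := hF.1 _ hS _ hx
  exact hy

/-- The maximal linked upfamily in which `p` has as many votes as all points of `S` but one. -/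
def box (p : X) (S : Set X) : Upfamily X where
  sets := {A | p ∈ A ∧ (A ∩ S).Nonempty ∨ S.Nonempty ∧ S ⊆ A}
  nonempty_of_mem := by
    rintro A (⟨h, -⟩ | ⟨h, h'⟩)
    exacts [⟨p, h⟩, h.mono h']
  mem_of_superset := by
    rintro A (⟨h, h'⟩ | ⟨h, h'⟩) B hAB
    exacts [Or.inl ⟨hAB h, h'.mono (Set.inter_subset_inter_left _ hAB)⟩, Or.inr ⟨h, h'.trans hAB⟩]

theorem mem_box {p : X} {S A : Set X} :
    A ∈ (box p S).sets ↔ p ∈ A ∧ (A ∩ S).Nonempty ∨ S.Nonempty ∧ S ⊆ A := Iff.rfl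

/-- A box over a pair is the two-out-of-three majority family, symmetric in its three points. -/
theorem mem_box_pair {p q r : X} {A : Set X} :
    A ∈ (box p {q, r}).sets ↔ p ∈ A ∧ (q ∈ A ∨ r ∈ A) ∨ q ∈ A ∧ r ∈ A := by
  simp [mem_box, Set.insert_subset_iff, Set.inter_nonempty]
  grind

theorem mem_box_triple {p q r s : X} {A : Set X} :
    A ∈ (box p {q, r, s}).sets ↔ p ∈ A ∧ (q ∈ A ∨ r ∈ A ∨ s ∈ A) ∨ q ∈ A ∧ r ∈ A ∧ s ∈ A := by
  simp [mem_box, Set.insert_subset_iff, Set.inter_nonempty]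
  grind

theorem isMaximalLinked_box (p : X) {S : Set X} (hS : S.Nonempty) : (box p S).IsMaximalLinked := by
  refine isMaximalLinked_of_forall ?_ fun A => ?_
  · rintro A (⟨h, h1⟩ | ⟨-, h⟩) B (⟨h', h1'⟩ | ⟨-, h'⟩)
    · exact ⟨p, h, h'⟩
    · exact h1.mono (Set.inter_subset_inter_right _ h')
    · rw [Set.inter_comm]
      exact h1'.mono (Set.inter_subset_inter_right _ h)
    · exact hS.mono (Set.subset_inter h h')
  · simp only [mem_box, hS, true_and, Set.mem_compl_iff]
    by_cases h1 : (A ∩ S).Nonempty <;> by_cases h2 : (Aᶜ ∩ S).Nonempty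
    · tauto
    · left; right
      intro x hx; by_contra hxA; exact h2 ⟨x, hxA, hx⟩
    · right; right
      intro x hx hxA; exact h1 ⟨x, hxA, hx⟩
    · obtain ⟨x, hx⟩ := hS
      by_cases hxA : x ∈ A
      · exact (h1 ⟨x, hxA, hx⟩).elim
      · exact (h2 ⟨x, hxA, hx⟩).elim

/-- The image of an upfamily under a map. -/
def map (f : X → Y) (F : Upfamily X) : Upfamily Y where
  sets := {S | f ⁻¹' S ∈ F.sets}
  nonempty_of_mem A hA := by
    obtain ⟨x, hx⟩ := F.nonempty_of_mem _ hA
    exact ⟨f x, hx⟩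
  mem_of_superset A hA B hAB := F.mem_of_superset _ hA _ (Set.preimage_mono hAB)

theorem mem_map {f : X → Y} {F : Upfamily X} {S : Set Y} : S ∈ (F.map f).sets ↔ f ⁻¹' S ∈ F.sets :=
  Iff.rfl

theorem map_equiv_symm (e : X ≃ Y) (F : Upfamily Y) : (F.map e.symm).map e = F := by
  ext S; simp [mem_map, ← Set.preimage_comp]

theorem map_mul [Mul X] [Mul Y] (e : X ≃* Y) (F G : Upfamily X) :
    (F * G).map e = F.map e * G.map e := by
  ext S; simp [mem_map, mem_mul]

theorem map_injective (e : X ≃ Y) : Function.Injective (map e) := by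
  intro F G h
  ext S
  have := congrArg (fun F : Upfamily Y => e.symm ⁻¹' S ∈ F.sets) h
  simpa [mem_map, ← Set.preimage_comp] using this

theorem IsMaximalLinked.map (e : X ≃ Y) {F : Upfamily X} (hF : F.IsMaximalLinked) :
    (F.map e).IsMaximalLinked := by
  rcases isEmpty_or_nonempty X with hX | hX
  -- Over the empty set the only upfamily is the empty one, and the complement criterion fails.
  · have hs : ∀ F : Upfamily Y, F.sets = ∅ := fun F => Set.eq_empty_of_forall_notMem fun S hS =>
      hX.false (e.symm (F.nonempty_of_mem S hS).some)
    refine ⟨fun A hA => ?_, fun G _ _ => Upfamily.ext ((hs _).trans (hs _).symm)⟩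
    rw [hs] at hA; exact hA.elim
  · refine isMaximalLinked_of_forall (fun A hA B hB => ?_) fun S => hF.mem_or_compl_mem (e ⁻¹' S)
    obtain ⟨x, hx⟩ := hF.1 _ hA _ hB
    exact ⟨e x, hx⟩

/-- An ultrafilter, regarded as an upfamily. -/
def ofUltrafilter (p : Ultrafilter X) : Upfamily X where
  sets := {A | A ∈ p}
  nonempty_of_mem _ hA := p.nonempty_of_mem hA
  mem_of_superset _ hA _ hAB := Filter.mem_of_superset hA hAB

theorem isMaximalLinked_ofUltrafilter (p : Ultrafilter X) : (ofUltrafilter p).IsMaximalLinked :=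
  isMaximalLinked_of_forall
    (fun _ hA _ hB => p.nonempty_of_mem (Filter.inter_mem hA hB)) p.mem_or_compl_mem

instance [Finite X] : Finite (Upfamily X) :=
  Finite.of_injective Upfamily.sets fun _ _ h => Upfamily.ext h

theorem IsMaximalLinked.mem_superextension [Semigroup X] {F : Upfamily X}
    (hF : F.IsMaximalLinked) : F ∈ superextension X := hF

end Upfamily

/-! ### Regular, inverse and Clifford semigroups -/

section Semigroups

variable {S : Type*} [Semigroup S]

/-- If y is the inverse of ef, then fye is one too, so y = fye is idempotent. An idempotent is its
own inverse, so y = ef by uniqueness. Once ef and fe are idempotent, both are inverses of ef. -/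
theorem IsInverseSemigroup.idempotentsCommute (h : IsInverseSemigroup S) :
    IdempotentsCommute S := by
  have key : ∀ e f : S, e * e = e → f * f = f → (e * f) * (e * f) = e * f := by
    intro e f he hf
    obtain ⟨y, ⟨h1, h2⟩, -⟩ := h (e * f)
    have he' : ∀ z, e * (e * z) = e * z := fun z => by rw [← mul_assoc, he]
    have hf' : ∀ z, f * (f * z) = f * z := fun z => by rw [← mul_assoc, hf]
    simp only [mul_assoc] at h1 h2
    have h2' : ∀ z, y * (e * (f * (y * z))) = y * z := fun z => by
      conv_rhs => rw [← h2]
      simp only [mul_assoc]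
    have hy : f * (y * e) = y := by
      refine (h (e * f)).unique ⟨?_, ?_⟩ ⟨?_, ?_⟩ <;>
        simp only [mul_assoc, he', hf', h1, h2, h2']
    have hyy : y * y = y := by
      rw [← hy]; simp only [mul_assoc, h2']
    have : e * f = y := by
      refine (h y).unique ⟨?_, ?_⟩ ⟨?_, ?_⟩ <;> simp only [mul_assoc, h1, h2, hyy]
    rw [this, hyy]
  intro e f he hf
  have h1 := key e f he hf
  have h2 := key f e hf he
  have he' : ∀ z, e * (e * z) = e * z := fun z => by rw [← mul_assoc, he]
  have hf' : ∀ z, f * (f * z) = f * z := fun z => by rw [← mul_assoc, hf]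
  simp only [mul_assoc] at h1 h2
  refine (h (e * f)).unique ⟨?_, ?_⟩ ⟨?_, ?_⟩ <;> simp only [mul_assoc, he', hf', h1, h2]

/-- An element with a commuting inverse lies in a subgroup. -/
theorem exists_isGroupSubsemigroup {x y : S} (h1 : x * y * x = x)
    (h3 : x * y = y * x) : ∃ G : Subsemigroup S, x ∈ G ∧ IsGroupSubsemigroup G := by
  have he : (x * y) * (x * y) = x * y := by rw [← mul_assoc, h1]
  set e := x * y with hedef
  let G : Subsemigroup S :=
    { carrier := {z | e * z = z ∧ z * e = z ∧ ∃ w, e * w = w ∧ w * e = w ∧ z * w = e ∧ w * z = e}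
      mul_mem' := by
        rintro a b ⟨h1, h2, w, h3, h4, h5, h6⟩ ⟨k1, k2, v, k3, k4, k5, k6⟩
        refine ⟨by rw [← mul_assoc, h1], by rw [mul_assoc, k2], v * w, by rw [← mul_assoc, k3],
          by rw [mul_assoc, h4], ?_, ?_⟩
        · rw [mul_assoc, ← mul_assoc b, k5, h3, h5]
        · rw [mul_assoc, ← mul_assoc w, h6, k1, k6] }
  have hxe : x * e = x := by rw [h3, ← mul_assoc, h1]
  -- Since y need not satisfy ey = y = ye, it is compressed to eye.
  refine ⟨G, ⟨h1, hxe, e * y * e, ?_, ?_, ?_, ?_⟩, e, ⟨he, he, e, he, he, he, he⟩,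
    fun z hz => ⟨hz.1, hz.2.1⟩, ?_⟩
  · simp only [← mul_assoc, he]
  · simp only [mul_assoc, he]
  · have : x * (e * y * e) = x * e * y * e := by simp only [mul_assoc]
    rw [this, hxe, ← hedef, he]
  · rw [mul_assoc, h1, mul_assoc, ← h3, he]
  · rintro z ⟨h1, h2, w, h3, h4, h5, h6⟩
    exact ⟨w, ⟨h3, h4, z, h1, h2, h6, h5⟩, h5, h6⟩

/-- If y and z are both inverses of x, commutativity gives xz = xyxz = xzxy = xy; then z = zxz = y.
-/
theorem IsCliffordSemigroup.isInverseSemigroup (hc : ∀ x y : S, x * y = y * x)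
    (h : IsCliffordSemigroup S) : IsInverseSemigroup S := by
  intro x
  obtain ⟨G, hx, e, -, he, hinv⟩ := h x
  obtain ⟨y, hy, hxy, -⟩ := hinv x hx
  have h1 : x * y * x = x := by rw [hxy, (he x hx).1]
  have h2 : y * x * y = y := by rw [hc y x, hxy, (he y hy).1]
  refine ⟨y, ⟨h1, h2⟩, fun z ⟨h3, h4⟩ => ?_⟩
  have e1 : x * z = x * y := by
    calc x * z = (x * y * x) * z := by rw [h1]
      _ = x * z * x * y := by rw [mul_assoc (x * y), hc (x * y), ← mul_assoc]
      _ = x * y := by rw [h3]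
  rw [← h4, mul_assoc, e1, ← mul_assoc, hc z x, e1, hc x y, h2]

end Semigroups

/-- The superextension is commutative and each of its elements is regular. -/
def CommRegularSuperextension (X : Type*) [Semigroup X] : Prop :=
  (∀ F G : Upfamily X, F.IsMaximalLinked → G.IsMaximalLinked → F * G = G * F) ∧
    ∀ F : Upfamily X, F.IsMaximalLinked → ∃ G : Upfamily X, G.IsMaximalLinked ∧ F * G * F = F

namespace CommRegularSuperextension

variable {X Y : Type*} [Semigroup X] [Semigroup Y]

theorem of_mulEquiv (h : CommRegularSuperextension Y) (e : X ≃* Y) :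
    CommRegularSuperextension X := by
  refine ⟨fun F G hF hG => Upfamily.map_injective e.toEquiv ?_, fun F hF => ?_⟩
  · have := h.1 _ _ (hF.map e.toEquiv) (hG.map e.toEquiv)
    exact (Upfamily.map_mul e F G).trans (this.trans (Upfamily.map_mul e G F).symm)
  · obtain ⟨G, hG, hFG⟩ := h.2 _ (hF.map e.toEquiv)
    refine ⟨G.map e.toEquiv.symm, hG.map _, Upfamily.map_injective e.toEquiv ?_⟩
    have h1 := Upfamily.map_mul e (F * G.map e.toEquiv.symm) F
    have h2 := Upfamily.map_mul e F (G.map e.toEquiv.symm)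
    have h3 := Upfamily.map_equiv_symm e.toEquiv G
    exact h1.trans ((congrArg (· * F.map e) (h2.trans (congrArg (F.map e * ·) h3))).trans hFG)

theorem commutative (h : CommRegularSuperextension X) (F G : superextension X) : F * G = G * F :=
  Subtype.ext (h.1 _ _ F.2 G.2)

theorem isCliffordSemigroup (h : CommRegularSuperextension X) :
    IsCliffordSemigroup (superextension X) := by
  intro F
  obtain ⟨G, hG, hFG⟩ := h.2 F.1 F.2
  exact exists_isGroupSubsemigroup (y := ⟨G, hG⟩) (Subtype.ext hFG) (h.commutative _ _)

theorem mul_comm (h : CommRegularSuperextension X) (x y : X) : x * y = y * x := by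
  have := h.1 _ _ (Upfamily.isMaximalLinked_principal x) (Upfamily.isMaximalLinked_principal y)
  rw [Upfamily.principal_mul, Upfamily.principal_mul] at this
  exact Upfamily.principal_injective this

end CommRegularSuperextension

/-! ### Selectors on finite chains and commutation of products -/

namespace Upfamily

variable {X : Type*}

/-- On a finite chain no non-empty sets `A`, `B` admit a selector of `S` in `B` for each point of
`A` together with a selector of the complement of `S` in `A` for each point of `B`. -/
theorem not_selectors_of_chain {L : Type*} [LinearOrder L] (S : Set L) (B : Finset L)
    (hB : B.Nonempty) : ∀ A : Finset L, (∀ b ∈ B, ∃ a ∈ A, min a b ∉ S) →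
      ¬ ∀ a ∈ A, ∃ b ∈ B, min a b ∈ S := by
  suffices H : ∀ (n : ℕ) (S : Set L) (A B : Finset L), A.card + B.card = n → B.Nonempty →
      (∀ b ∈ B, ∃ a ∈ A, min a b ∉ S) → ¬ ∀ a ∈ A, ∃ b ∈ B, min a b ∈ S from
    fun A => H _ S A B rfl hB
  intro n
  induction n with
  | zero =>
    intro S A B hn hB
    have := hB.card_pos
    omega
  | succ n ih =>
    -- Let the least point m of A lie below all of B. Then min m b = m for every b in B, so m is in
    -- S and never serves as a selector of the complement: it can be erased from A.
    have key : ∀ (S : Set L) (A B : Finset L), A.card + B.card = n + 1 → B.Nonempty →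
        (hA : A.Nonempty) → (∀ b ∈ B, A.min' hA ≤ b) →
        (∀ b ∈ B, ∃ a ∈ A, min a b ∉ S) → ¬ ∀ a ∈ A, ∃ b ∈ B, min a b ∈ S := by
      intro S A B hn hB hA hle h1 h2
      have hm := A.min'_mem hA
      have hmS : A.min' hA ∈ S := by
        obtain ⟨b, hb, hb'⟩ := h2 _ hm
        rwa [min_eq_left (hle b hb)] at hb'
      refine ih S (A.erase (A.min' hA)) B ?_ hB (fun b hb => ?_)
        fun a ha => h2 a (Finset.mem_of_mem_erase ha)
      · rw [Finset.card_erase_of_mem hm]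
        have := hA.card_pos
        omega
      · obtain ⟨a, ha, hab⟩ := h1 b hb
        refine ⟨a, Finset.mem_erase.2 ⟨?_, ha⟩, hab⟩
        rintro rfl
        rw [min_eq_left (hle b hb)] at hab
        exact hab hmS
    intro S A B hn hB h1 h2
    have hA : A.Nonempty := by
      obtain ⟨b, hb⟩ := hB
      obtain ⟨a, ha, -⟩ := h1 b hb
      exact ⟨a, ha⟩
    rcases le_total (A.min' hA) (B.min' hB) with h | h
    · exact key S A B hn hB hA (fun b hb => h.trans (B.min'_le b hb)) h1 h2
    -- Exchanging A and B exchanges S and its complement.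
    · refine key Sᶜ B A (by omega) hA hB (fun a ha => h.trans (A.min'_le a ha)) (fun a ha => ?_)
        fun b hb => ?_
      · obtain ⟨b, hb, hab⟩ := h2 a ha
        exact ⟨b, hb, by rw [min_comm]; simpa using hab⟩
      · obtain ⟨a, ha, hab⟩ := h1 b hb
        exact ⟨a, ha, by rw [min_comm]; exact hab⟩

/-- If a maximal linked product contains `S` and the opposite product contains `Sᶜ`, then this is
witnessed by members `A` and `B` of the factors. -/
theorem exists_mem_of_mem_mul [Semigroup X] (hc : ∀ x y : X, x * y = y * x) {F G : Upfamily X}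
    {S : Set X} (h1 : S ∈ (F * G).sets) (h2 : Sᶜ ∈ (G * F).sets) :
    ∃ A ∈ F.sets, ∃ B ∈ G.sets, (∀ a ∈ A, {b | a * b ∈ S} ∈ G.sets) ∧
      ∀ b ∈ B, {a | a * b ∉ S} ∈ F.sets := by
  rw [mem_mul] at h1 h2
  refine ⟨_, h1, _, h2, fun a ha => ha, fun b hb => ?_⟩
  have : {a | a * b ∉ S} = {a | b * a ∈ Sᶜ} := by ext a; simp [hc]
  rw [this]
  exact hb

/-- The sets pulled back from a finite chain do not distinguish the two products of maximal linked
upfamilies. -/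
theorem not_mem_mul_of_chain [Semigroup X] [Finite X] (hc : ∀ x y : X, x * y = y * x)
    {L : Type*} [LinearOrder L] (r : X → L) (hr : ∀ x y, r (x * y) = min (r x) (r y))
    {F G : Upfamily X} (hF : F.IsLinked) (hG : G.IsLinked) {S : Set X}
    (hS : ∀ x y, r x = r y → x ∈ S → y ∈ S) (h1 : S ∈ (F * G).sets) (h2 : Sᶜ ∈ (G * F).sets) :
    False := by
  classical
  obtain ⟨_⟩ := nonempty_fintype X
  have hS' : ∀ x, r x ∈ r '' S ↔ x ∈ S := fun x =>
    ⟨fun ⟨y, hy, hyx⟩ => hS y x hyx hy, fun hx => ⟨x, hx, rfl⟩⟩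
  obtain ⟨A, hA, B, hB, hAB, hBA⟩ := exists_mem_of_mem_mul hc h1 h2
  refine not_selectors_of_chain (r '' S) (B.toFinset.image r)
    (by simpa using G.nonempty_of_mem _ hB) (A.toFinset.image r) (fun b hb => ?_) fun a ha => ?_
  · simp only [Finset.mem_image, Set.mem_toFinset] at hb ⊢
    obtain ⟨b, hb, rfl⟩ := hb
    -- Linkedness of F makes A meet the set of good left factors of b, so the selector can be taken
    -- inside A.
    obtain ⟨a, ha, ha'⟩ := hF _ hA _ (hBA b hb)
    exact ⟨r a, ⟨a, ha, rfl⟩, by rwa [← hr, hS']⟩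
  · simp only [Finset.mem_image, Set.mem_toFinset] at ha ⊢
    obtain ⟨a, ha, rfl⟩ := ha
    obtain ⟨b, hb, hb'⟩ := hG _ hB _ (hAB a ha)
    exact ⟨r b, ⟨b, hb, rfl⟩, by rwa [← hr, hS']⟩

theorem IsMaximalLinked.mul_self_eq [Semigroup X] [Nonempty X] {F : Upfamily X}
    (hF : F.IsMaximalLinked) (h : ∀ S, S ∈ (F * F).sets → Sᶜ ∈ F.sets → False) : F * F = F :=
  (hF.mul hF).eq_of_disjoint hF h

theorem commute_principal [Semigroup X] (hc : ∀ x y : X, x * y = y * x) (x : X)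
    (F : Upfamily X) : principal x * F = F * principal x := by
  ext S
  simp only [mem_mul, mem_principal, Set.mem_ofPred_eq, hc]

end Upfamily

/-! ### Superextensions of finite chains, with or without a group of order two below -/

open Upfamily

theorem commRegularSuperextension_of_isEmpty (X : Type*) [Semigroup X] [IsEmpty X] :
    CommRegularSuperextension X := by
  have hs : ∀ F G : Upfamily X, F = G := fun F G => by
    ext S
    exact ⟨fun h => (IsEmpty.false (F.nonempty_of_mem S h).some).elim,
      fun h => (IsEmpty.false (G.nonempty_of_mem S h).some).elim⟩
  exact ⟨fun _ _ _ _ => hs _ _, fun F hF => ⟨F, hF, hs _ _⟩⟩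

theorem commRegularSuperextension_linSemilattice (n : ℕ) :
    CommRegularSuperextension (LinSemilattice n) := by
  rcases isEmpty_or_nonempty (LinSemilattice n) with hX | hX
  · exact commRegularSuperextension_of_isEmpty _
  have : Finite (LinSemilattice n) := inferInstanceAs (Finite (Fin n))
  let r : LinSemilattice n → Fin n := id
  have hr : ∀ x y, r (x * y) = min (r x) (r y) := fun _ _ => rfl
  have hc : ∀ x y : LinSemilattice n, x * y = y * x := fun x y => min_comm (r x) (r y)
  have idem : ∀ F : Upfamily (LinSemilattice n), F.IsMaximalLinked → F * F = F := by
    intro F hF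
    refine hF.mul_self_eq fun S h1 h2 => ?_
    rw [mem_mul] at h1
    -- Both a and b will lie outside S while ab, being one of them, lies in S.
    obtain ⟨a, ha, haS⟩ := hF.1 _ h1 _ h2
    obtain ⟨b, hb, hbS⟩ := hF.1 _ ha _ h2
    have : a * b = a ∨ a * b = b := min_choice (r a) (r b)
    rcases this with h | h <;> rw [Set.mem_ofPred_eq, h] at hb
    exacts [haS hb, hbS hb]
  refine ⟨fun F G hF hG => ?_, fun F hF => ⟨F, hF, by rw [idem F hF, idem F hF]⟩⟩
  exact (hF.mul hG).eq_of_disjoint (hG.mul hF) fun S h1 h2 =>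
    not_mem_mul_of_chain hc r hr hF.1 hG.1 (fun x y h hx => by rwa [← show x = y from h]) h1 h2

/-- A finite chain with a group `{e, g}` of order two adjoined below it. -/
theorem commRegularSuperextension_of_bottom_two {X L : Type*} [Semigroup X] [Finite X]
    [LinearOrder L] (r : X → L) (hr : ∀ x y, r (x * y) = min (r x) (r y)) {e g : X}
    (hc : ∀ x y : X, x * y = y * x)
    (he : ∀ x, x ≠ g → e * x = e) (hg : ∀ x, x ≠ g → g * x = g) (heg : e * g = g)
    (hgg : g * g = e)
    (hinj : ∀ x y, r x = r y → x = y ∨ (x = e ∨ x = g) ∧ (y = e ∨ y = g)) :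
    CommRegularSuperextension X := by
  classical
  have : Nonempty X := ⟨e⟩
  obtain ⟨_⟩ := nonempty_fintype X
  have hch : ∀ x y, x ≠ e → x ≠ g → x * y = x ∨ x * y = y := by
    intro x y hxe hxg
    by_cases hye : y = e
    · rw [hye, hc, he x hxg]; exact Or.inr rfl
    by_cases hyg : y = g
    · rw [hyg, hc, hg x hxg]; exact Or.inr rfl
    rcases min_choice (r x) (r y) with h | h <;> rw [← hr] at h
    · rcases hinj _ _ h with h | h
      · exact Or.inl h
      · tauto
    · rcases hinj _ _ h with h | h
      · exact Or.inr h
      · tauto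
  -- A set that does not separate e from g is a union of fibres of r, so the chain argument covers
  -- it.
  have htriv : ∀ S : Set X, (e ∈ S ↔ g ∈ S) → ∀ x y, r x = r y → x ∈ S → y ∈ S := by
    intro S hS x y hxy hx
    rcases hinj x y hxy with rfl | ⟨rfl | rfl, rfl | rfl⟩ <;> tauto
  have hsep : ∀ F G : Upfamily X, F.IsMaximalLinked → G.IsMaximalLinked → F ≠ principal g →
      G ≠ principal g → ∀ S : Set X, e ∈ S → g ∉ S → S ∈ (F * G).sets → Sᶜ ∈ (G * F).sets →
      False := by
    intro F G hF hG hFg hGg S heS hgS h1 h2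
    obtain ⟨A, hA, B, hB, hAB, hBA⟩ := exists_mem_of_mem_mul hc h1 h2
    -- Since gb = g ∉ S for b ≠ g, having g in A would put a subset of {g} into G. Likewise ae = e ∈
    -- S for a ≠ g keeps e out of B.
    have hgA : g ∉ A := fun h => hGg <| hG.eq_principal <|
      G.mem_of_superset _ (hAB g h) _ fun b (hb : g * b ∈ S) => by
        by_contra hbg
        exact hgS (hg b hbg ▸ hb)
    have heB : e ∉ B := fun h => hFg <| hF.eq_principal <|
      F.mem_of_superset _ (hBA e h) _ fun a (ha : a * e ∉ S) => by
        by_contra hag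
        rw [hc, he a hag] at ha
        exact ha heS
    have key : ∀ x, x ≠ e → x ≠ g → (r x ∈ r '' (S \ {e}) ↔ x ∈ S) := by
      refine fun x hxe hxg => ⟨fun ⟨y, hy, hyx⟩ => ?_, fun hx => ⟨x, ⟨hx, hxe⟩, rfl⟩⟩
      rcases hinj _ _ hyx with rfl | h
      · exact hy.1
      · tauto
    have hne : ∀ x ∈ A, ∀ y ∈ B, x ≠ e → y ≠ g → x * y ≠ e ∧ x * y ≠ g := by
      intro x hx y hy hxe hyg
      rcases hch x y hxe (fun h => hgA (h ▸ hx)) with h | h <;> rw [h]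
      · exact ⟨hxe, fun h => hgA (h ▸ hx)⟩
      · exact ⟨fun h => heB (h ▸ hy), hyg⟩
    -- Selectors never use e in A (eb = e ∈ S) or g in B (ag = g ∉ S). After removing these points
    -- all products avoid {e, g}, where r is injective, so `S \ {e}` can be read on the chain.
    refine not_selectors_of_chain (r '' (S \ {e})) ((B \ {g}).toFinset.image r) ?_
      ((A \ {e}).toFinset.image r) (fun b hb => ?_) fun a ha => ?_
    · by_contra hBg
      refine hGg (hG.eq_principal (G.mem_of_superset _ hB _ fun b hb => ?_))
      by_contra hbg
      exact hBg ⟨r b, by simpa using ⟨b, ⟨hb, hbg⟩, rfl⟩⟩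
    · simp only [Finset.mem_image, Set.mem_toFinset] at hb ⊢
      obtain ⟨b, ⟨hb, hbg : b ≠ g⟩, rfl⟩ := hb
      obtain ⟨a, ha, hab : a * b ∉ S⟩ := hF.1 _ hA _ (hBA b hb)
      have hae : a ≠ e := by
        rintro rfl
        rw [he b hbg] at hab
        exact hab heS
      refine ⟨r a, ⟨a, ⟨ha, hae⟩, rfl⟩, ?_⟩
      rwa [← hr, key _ (hne a ha b hb hae hbg).1 (hne a ha b hb hae hbg).2]
    · simp only [Finset.mem_image, Set.mem_toFinset] at ha ⊢
      obtain ⟨a, ⟨ha, hae : a ≠ e⟩, rfl⟩ := ha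
      obtain ⟨b, hb, hab : a * b ∈ S⟩ := hG.1 _ hB _ (hAB a ha)
      have hbg : b ≠ g := by
        rintro rfl
        rw [hc, hg a (fun h => hgA (h ▸ ha))] at hab
        exact hgS hab
      refine ⟨r b, ⟨b, ⟨hb, hbg⟩, rfl⟩, ?_⟩
      rwa [← hr, key _ (hne a ha b hb hae hbg).1 (hne a ha b hb hae hbg).2]
  refine ⟨fun F G hF hG => ?_, fun F hF => ?_⟩
  · by_cases hFg : F = principal g
    · rw [hFg, commute_principal hc]
    by_cases hGg : G = principal g
    · rw [hGg, commute_principal hc]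
    refine (hF.mul hG).eq_of_disjoint (hG.mul hF) fun S h1 h2 => ?_
    by_cases heS : e ∈ S <;> by_cases hgS : g ∈ S
    · exact not_mem_mul_of_chain hc r hr hF.1 hG.1 (htriv S (by tauto)) h1 h2
    · exact hsep F G hF hG hFg hGg S heS hgS h1 h2
    · exact hsep G F hG hF hGg hFg Sᶜ heS (by simpa using hgS) h2 (by rwa [compl_compl])
    · exact not_mem_mul_of_chain hc r hr hF.1 hG.1 (htriv S (by tauto)) h1 h2
  · by_cases hFg : F = principal g
    · refine ⟨F, hF, ?_⟩
      rw [hFg, principal_mul, principal_mul, hgg, heg]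
    -- A point a ∈ {e, g} outside S satisfies ab = a ∉ S for b ≠ g, which would force {g} into F;
    -- for any other a, the product ab is a or b, both outside S.
    have : F * F = F := by
      refine hF.mul_self_eq fun S h1 h2 => ?_
      rw [mem_mul] at h1
      obtain ⟨a, ha, haS : a ∉ S⟩ := hF.1 _ h1 _ h2
      have hnot : ¬ {b | a * b ∈ S} ⊆ {g} := fun h =>
        hFg (hF.eq_principal (F.mem_of_superset _ ha _ h))
      obtain ⟨b, hb, hbS : b ∉ S⟩ := hF.1 _ ha _ h2
      rw [Set.mem_ofPred_eq] at hb
      by_cases hae : a = e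
      · subst hae
        exact hnot fun b (hb : a * b ∈ S) => by
          by_contra hbg
          exact haS (he b hbg ▸ hb)
      by_cases hag : a = g
      · subst hag
        exact hnot fun b (hb : a * b ∈ S) => by
          by_contra hbg
          exact haS (hg b hbg ▸ hb)
      rcases hch a b hae hag with h | h <;> rw [h] at hb <;> contradiction
    exact ⟨F, hF, by rw [this, this]⟩

theorem cyclicGrp_two_eq (x : CyclicGrp 2) : x = 1 ∨ x = Multiplicative.ofAdd 1 := by
  revert x; decide

theorem commRegularSuperextension_two_orderedUnion (n : ℕ) :
    CommRegularSuperextension (OrderedUnion (CyclicGrp 2) (LinSemilattice n)) := by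
  have : Finite (OrderedUnion (CyclicGrp 2) (LinSemilattice n)) :=
    inferInstanceAs (Finite (CyclicGrp 2 ⊕ Fin n))
  have hL : ∀ x y : LinSemilattice n, x * y = y * x := fun x y =>
    min_comm (α := Fin n) x y
  let r : OrderedUnion (CyclicGrp 2) (LinSemilattice n) → WithBot (Fin n) :=
    Sum.elim (fun _ => ⊥) (fun i : Fin n => (i : WithBot (Fin n)))
  let t : LinSemilattice n → OrderedUnion (CyclicGrp 2) (LinSemilattice n) := Sum.inr
  let e : OrderedUnion (CyclicGrp 2) (LinSemilattice n) := Sum.inl 1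
  let g : OrderedUnion (CyclicGrp 2) (LinSemilattice n) := Sum.inl (Multiplicative.ofAdd 1)
  have hx : ∀ x, x = e ∨ x = g ∨ ∃ i, x = t i := by
    rintro (x | x)
    · rcases cyclicGrp_two_eq x with rfl | rfl
      exacts [Or.inl rfl, Or.inr (Or.inl rfl)]
    · exact Or.inr (Or.inr ⟨x, rfl⟩)
  have hgg : g * g = e := rfl
  have heg : e * g = g := rfl
  have hge : g * e = g := rfl
  have hee : e * e = e := rfl
  have hei : ∀ i, e * t i = e := fun i => rfl
  have hgi : ∀ i, g * t i = g := fun i => rfl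
  refine commRegularSuperextension_of_bottom_two r (e := e) (g := g) ?_ ?_ ?_ ?_ heg hgg ?_
  · rintro (x | x) (y | y)
    · rfl
    · exact (min_eq_left bot_le).symm
    · exact (min_eq_right bot_le).symm
    · exact (WithBot.coe_min (α := Fin n) x y)
  · rintro (x | x) (y | y)
    · exact congrArg Sum.inl (mul_comm x y)
    · rfl
    · rfl
    · exact congrArg Sum.inr (hL x y)
  · intro x hxg
    rcases hx x with rfl | rfl | ⟨i, rfl⟩
    exacts [hee, (hxg rfl).elim, hei i]
  · intro x hxg
    rcases hx x with rfl | rfl | ⟨i, rfl⟩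
    exacts [hge, (hxg rfl).elim, hgi i]
  · intro x y h
    rcases hx x with rfl | rfl | ⟨i, rfl⟩ <;> rcases hx y with rfl | rfl | ⟨j, rfl⟩
    · tauto
    · tauto
    · exact (WithBot.bot_ne_coe h).elim
    · tauto
    · tauto
    · exact (WithBot.bot_ne_coe h).elim
    · exact (WithBot.coe_ne_bot h).elim
    · exact (WithBot.coe_ne_bot h).elim
    · exact Or.inl (congrArg Sum.inr (WithBot.coe_injective h))

open Upfamily

/-! ### Superextensions of small semigroups, by computation

A subset of an `n`-element set is coded by a number below `2 ^ n`, a family of subsets by a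
Boolean function of such numbers, and a maximal linked upfamily by its restriction to the first half
of the codes. -/

namespace SmallSuperextension

/-- The self-dual family of codes with restriction `b` to the first half of the codes. -/
def memCode (n b k : ℕ) : Bool :=
  if k < 2 ^ (n - 1) then b.testBit k else !b.testBit (2 ^ n - 1 - k)

/-- The product of two coded families for a multiplication table `t`. -/
def mulCode (n : ℕ) (t : ℕ → ℕ → ℕ) (f g : ℕ → Bool) (k : ℕ) : Bool :=
  f (Nat.ofBits fun a : Fin n => g (Nat.ofBits fun b : Fin n => k.testBit (t a b)))

/-- Equality of coded families. -/
def eqCode (n : ℕ) (f g : ℕ → Bool) : Bool :=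
  (List.range (2 ^ n)).all fun k => f k == g k

/-- The coded family is linked. -/
def linkedCode (n : ℕ) (f : ℕ → Bool) : Bool :=
  (List.range (2 ^ n)).all fun i => !f i || (List.range (2 ^ n)).all fun j =>
    !f j || (i &&& j) != 0

/-- The codes of the maximal linked upfamilies. -/
def codes (n : ℕ) : List ℕ :=
  (List.range (2 ^ 2 ^ (n - 1))).filter fun b => linkedCode n (memCode n b)

/-- Commutativity and regularity for coded families. -/
def check (n : ℕ) (t : ℕ → ℕ → ℕ) (l : List ℕ) : Bool :=
  (l.all fun b => l.all fun c =>
    eqCode n (mulCode n t (memCode n b) (memCode n c)) (mulCode n t (memCode n c) (memCode n b))) &&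
  l.all fun b =>
    let f := memCode n b
    -- F⁴ = F handles elements of period 1 or 3, and F⁵ = F those of period 1, 2 or 4.
    eqCode n (mulCode n t (mulCode n t f (mulCode n t f f)) f) f ||
      eqCode n (mulCode n t (mulCode n t f (mulCode n t f (mulCode n t f f))) f) f

variable {X : Type*} {n : ℕ} (e : X ≃ Fin n)

open Classical in
/-- The code of a set. -/
noncomputable def code (S : Set X) : ℕ := Nat.ofBits fun i : Fin n => decide (e.symm i ∈ S)

theorem code_lt (S : Set X) : code e S < 2 ^ n := Nat.ofBits_lt_two_pow _

theorem testBit_code (S : Set X) (x : X) : (code e S).testBit (e x) = true ↔ x ∈ S := by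
  rw [code, Nat.testBit_ofBits_lt _ _ (e x).2]; simp

theorem code_eq {S : Set X} {k : ℕ} (hk : k < 2 ^ n) (h : ∀ x, k.testBit (e x) = true ↔ x ∈ S) :
    code e S = k := by
  refine Nat.eq_of_testBit_eq fun i => ?_
  by_cases hi : i < n
  · have h1 := testBit_code e S (e.symm ⟨i, hi⟩)
    have h2 := h (e.symm ⟨i, hi⟩)
    rw [Equiv.apply_symm_apply] at h1 h2
    exact Bool.eq_iff_iff.2 (h1.trans h2.symm)
  · have : 2 ^ n ≤ 2 ^ i := Nat.pow_le_pow_right (by norm_num) (by omega)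
    rw [Nat.testBit_lt_two_pow ((code_lt e S).trans_le this), Nat.testBit_lt_two_pow (hk.trans_le this)]

theorem code_setOf {k : ℕ} (hk : k < 2 ^ n) : code e {x | k.testBit (e x) = true} = k :=
  code_eq e hk fun _ => Iff.rfl

theorem setOf_testBit_code (S : Set X) : {x | (code e S).testBit (e x) = true} = S :=
  Set.ext fun x => testBit_code e S x

theorem code_compl (S : Set X) : code e Sᶜ = 2 ^ n - 1 - code e S := by
  have h := code_lt e S
  refine code_eq e (by omega) fun x => ?_
  have : 2 ^ n - 1 - code e S = 2 ^ n - (code e S + 1) := by omega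
  rw [this, Nat.testBit_two_pow_sub_succ h, Set.mem_compl_iff, ← testBit_code e S x]
  simp

/-- The Boolean function `f` codes the upfamily `F`. -/
def Codes (F : Upfamily X) (f : ℕ → Bool) : Prop := ∀ S, S ∈ F.sets ↔ f (code e S) = true

variable {e}

theorem exists_codes [Nonempty X] {F : Upfamily X} (hF : F.IsMaximalLinked) :
    ∃ b ∈ codes n, Codes e F (memCode n b) := by
  classical
  have hn : 0 < n := (e (Classical.arbitrary X)).pos
  have hn' : 2 ^ n = 2 * 2 ^ (n - 1) := by rw [← pow_succ', Nat.sub_add_cancel hn]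
  let b := Nat.ofBits fun k : Fin (2 ^ (n - 1)) => decide ({x | k.1.testBit (e x) = true} ∈ F.sets)
  have hlt : ∀ S, code e S < 2 ^ (n - 1) → (S ∈ F.sets ↔ b.testBit (code e S) = true) := by
    intro S hS
    rw [Nat.testBit_ofBits_lt _ _ hS]
    simp [setOf_testBit_code]
  have hb : Codes e F (memCode n b) := by
    intro S
    unfold memCode
    split_ifs with h
    · exact hlt S h
    -- A code in the upper half has its complement in the lower half, and maximality turns
    -- membership of the complement into non-membership.
    · rw [← code_compl, Bool.not_eq_true', ← Bool.not_eq_true,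
        ← hlt Sᶜ (by rw [code_compl]; have := code_lt e S; omega), hF.compl_mem_iff, not_not]
  refine ⟨b, ?_, hb⟩
  simp only [codes, List.mem_filter, List.mem_range, linkedCode, List.all_eq_true, Bool.or_eq_true,
    Bool.not_eq_true', bne_iff_ne]
  refine ⟨Nat.ofBits_lt_two_pow _, fun i hi => ?_⟩
  by_contra! h
  obtain ⟨h1, j, hj, h2, h3⟩ := h
  replace h1 := Bool.eq_true_of_not_eq_false h1
  replace h2 := Bool.eq_true_of_not_eq_false h2
  rw [← code_setOf e hi, ← hb] at h1
  rw [← code_setOf e hj, ← hb] at h2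
  obtain ⟨x, hx, hx'⟩ := hF.1 _ h1 _ h2
  have : (i &&& j).testBit (e x) = true := by
    rw [Nat.testBit_land, hx, hx']; rfl
  rw [h3] at this
  simp at this

theorem Codes.mul [Semigroup X] {t : ℕ → ℕ → ℕ} (ht : ∀ x y, (e (x * y) : ℕ) = t (e x) (e y))
    {F G : Upfamily X} {f g : ℕ → Bool} (hF : Codes e F f) (hG : Codes e G g) :
    Codes e (F * G) (mulCode n t f g) := by
  intro S
  have hofBits : ∀ p : Fin n → Bool, Nat.ofBits p = code e {x | p (e x) = true} := by
    intro p; simp [code]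
  rw [mem_mul, hF, mulCode, hofBits]
  have hG' : ∀ a, {b | a * b ∈ S} ∈ G.sets ↔
      g (Nat.ofBits fun b : Fin n => (code e S).testBit (t (e a) b)) = true := by
    intro a
    rw [hG, hofBits]
    simp only [← ht, testBit_code]
  simp only [hG']

theorem Codes.eq {F G : Upfamily X} {f g : ℕ → Bool} (hF : Codes e F f) (hG : Codes e G g)
    (h : eqCode n f g = true) : F = G := by
  ext S
  simp only [eqCode, List.all_eq_true, List.mem_range, beq_iff_eq] at h
  rw [hF, hG, h _ (code_lt e S)]

/-- Every maximal linked upfamily has a code in `codes n`, and the coding respects products, so a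
Boolean test over this finite list decides the property. -/
theorem commRegularSuperextension [Semigroup X] (hn : 0 < n) (e : X ≃ Fin n) {t : ℕ → ℕ → ℕ}
    (ht : ∀ x y, (e (x * y) : ℕ) = t (e x) (e y)) (h : check n t (codes n) = true) :
    CommRegularSuperextension X := by
  have : Nonempty X := ⟨e.symm ⟨0, hn⟩⟩
  simp only [check, Bool.and_eq_true, List.all_eq_true, Bool.or_eq_true] at h
  refine ⟨fun F G hF hG => ?_, fun F hF => ?_⟩
  · obtain ⟨b, hb, hFb⟩ := exists_codes (e := e) hF
    obtain ⟨c, hc, hGc⟩ := exists_codes (e := e) hG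
    exact (hFb.mul ht hGc).eq (hGc.mul ht hFb) (h.1 b hb c hc)
  · obtain ⟨b, hb, hFb⟩ := exists_codes (e := e) hF
    rcases h.2 b hb with h | h
    · exact ⟨F * F, hF.mul hF, ((hFb.mul ht (hFb.mul ht hFb)).mul ht hFb).eq hFb h⟩
    · exact ⟨F * (F * F), hF.mul (hF.mul hF),
        ((hFb.mul ht (hFb.mul ht (hFb.mul ht hFb))).mul ht hFb).eq hFb h⟩

end SmallSuperextension

open SmallSuperextension

instance (n : ℕ) : Fintype (LinSemilattice n) := inferInstanceAs (Fintype (Fin n))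

theorem commRegularSuperextension_cyclicGrp_three : CommRegularSuperextension (CyclicGrp 3) :=
  commRegularSuperextension (n := 3) (by norm_num) (Multiplicative.toAdd.trans (Equiv.refl (Fin 3)))
    (t := fun a b => (a + b) % 3) (by decide) (by decide +kernel)

theorem commRegularSuperextension_cyclicGrp_four : CommRegularSuperextension (CyclicGrp 4) :=
  commRegularSuperextension (n := 4) (by norm_num) (Multiplicative.toAdd.trans (Equiv.refl (Fin 4)))
    (t := fun a b => (a + b) % 4) (by decide) (by decide +kernel)

theorem commRegularSuperextension_cyclicGrp_two_prod :
    CommRegularSuperextension (CyclicGrp 2 × CyclicGrp 2) :=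
  commRegularSuperextension (n := 4) (by norm_num)
    ((Equiv.prodCongr (Multiplicative.toAdd.trans (Equiv.refl (Fin 2)))
      (Multiplicative.toAdd.trans (Equiv.refl (Fin 2)))).trans finProdFinEquiv)
    -- The two factors are the two binary digits, added without carry.
    (t := fun a b => a ^^^ b) (by decide) (by decide +kernel)

theorem commRegularSuperextension_linSemilattice_two_prod :
    CommRegularSuperextension (LinSemilattice 2 × CyclicGrp 2) :=
  commRegularSuperextension (n := 4) (by norm_num)
    ((Equiv.prodCongr (Equiv.refl (Fin 2))
      (Multiplicative.toAdd.trans (Equiv.refl (Fin 2)))).trans finProdFinEquiv)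
    -- The high digit is the chain coordinate and the low digit the group coordinate.
    (t := fun a b => 2 * min (a / 2) (b / 2) + (a + b) % 2)
    (by decide) (by decide +kernel)

theorem commRegularSuperextension_one_orderedUnion :
    CommRegularSuperextension (OrderedUnion (LinSemilattice 1) (CyclicGrp 2)) :=
  commRegularSuperextension (n := 3) (by norm_num)
    ((Equiv.sumCongr (Equiv.refl (Fin 1))
      (Multiplicative.toAdd.trans (Equiv.refl (Fin 2)))).trans finSumFinEquiv)
    -- 0 codes the zero element and 1 + c the group element c.
    (t := fun a b => if a = 0 ∨ b = 0 then 0 else 1 + (a + b) % 2)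
    (by rintro (x | x) (y | y) <;> revert x y <;> decide) (by decide +kernel)

/-! ### Idempotent ultrafilters and infinite subsemigroups -/

open Upfamily

-- On ultrafilters the product of upfamilies is the usual product of ultrafilters.
open Filter in
theorem Upfamily.mem_ofUltrafilter_mul {X T : Type*} [Semigroup X] {p q : Ultrafilter T}
    {i : T → X} {S : Set X} :
    S ∈ (ofUltrafilter (p.map i) * ofUltrafilter (q.map i)).sets ↔
      ∀ᶠ a in (p : Filter T), ∀ᶠ b in (q : Filter T), i a * i b ∈ S := by
  rw [mem_mul]; rfl

theorem IdempotentsCommute.mul_comm_of_isMaximalLinked {X : Type*} [Semigroup X]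
    (h : IdempotentsCommute (superextension X)) {F G : Upfamily X} (hF : F.IsMaximalLinked)
    (hG : G.IsMaximalLinked) (hFF : F * F = F) (hGG : G * G = G) : F * G = G * F :=
  congrArg Subtype.val
    (h ⟨F, hF.mem_superextension⟩ ⟨G, hG.mem_superextension⟩ (Subtype.ext hFF) (Subtype.ext hGG))

open Filter in
/-- An infinite countable left cancellative semigroup contains two disjoint thick sets. -/
theorem exists_disjoint_thick (T : Type*) [Semigroup T] [Countable T] [Infinite T]
    [IsLeftCancelMul T] :
    ∃ A B : Set T, Disjoint A B ∧ (∃ y : ℕ → T, ∀ g, ∀ᶠ n in atTop, g * y n ∈ A) ∧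
      ∃ y : ℕ → T, ∀ g, ∀ᶠ n in atTop, g * y n ∈ B := by
  classical
  obtain ⟨t, ht⟩ := exists_surjective_nat T
  -- `f n` is a pair (Nₙ, yₙ), with N strictly increasing, such that the blocks {tᵢ yₙ : i ≤ Nₙ} are
  -- pairwise disjoint. At each stage left cancellation leaves only a finite set D of forbidden y.
  obtain ⟨f, -, hf⟩ := exists_seq_of_forall_finset_exists (α := ℕ × T) (fun _ => True)
    (fun a b => a.1 < b.1 ∧ ∀ i ≤ a.1, ∀ j ≤ b.1, t i * a.2 ≠ t j * b.2) fun s _ => by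
      let n := s.sup Prod.fst + 1
      let D : Set T := ⋃ a ∈ s, ⋃ i ∈ Set.Iic a.1, ⋃ j ∈ Set.Iic n, {y | t i * a.2 = t j * y}
      have hD : D.Finite := by
        refine s.finite_toSet.biUnion fun a _ => (Set.finite_Iic _).biUnion fun i _ =>
          (Set.finite_Iic _).biUnion fun j _ => Set.Subsingleton.finite fun y hy z hz => ?_
        exact mul_left_cancel (hy.symm.trans hz)
      obtain ⟨y, hy⟩ := hD.exists_notMem
      refine ⟨(n, y), trivial, fun a ha => ⟨Nat.lt_succ_of_le (Finset.le_sup (f := Prod.fst) ha),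
        fun i hi j hj h => hy ?_⟩⟩
      simp only [D, Set.mem_iUnion]
      exact ⟨a, ha, i, hi, j, hj, h⟩
  have hmono : StrictMono fun n => (f n).1 := fun m n h => (hf m n h).1
  have hdisj : ∀ m n, m ≠ n → ∀ i ≤ (f m).1, ∀ j ≤ (f n).1, t i * (f m).2 ≠ t j * (f n).2 := by
    intro m n hmn i hi j hj
    rcases lt_or_gt_of_ne hmn with h | h
    · exact (hf m n h).2 i hi j hj
    · exact ((hf n m h).2 j hj i hi).symm
  -- The even and the odd blocks; a translate by tᵢ stays in its blocks as soon as Nₙ ≥ i.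
  let A : ℕ → Set T := fun r => {x | ∃ n, n % 2 = r ∧ ∃ i ≤ (f n).1, x = t i * (f n).2}
  have key : ∀ r < 2, ∃ y : ℕ → T, ∀ g, ∀ᶠ n in atTop, g * y n ∈ A r := by
    refine fun r hr => ⟨fun n => (f (2 * n + r)).2, fun g => ?_⟩
    obtain ⟨i, rfl⟩ := ht g
    filter_upwards [eventually_ge_atTop i] with n hn
    exact ⟨2 * n + r, by omega, i, le_trans (by omega) (hmono.le_apply (x := 2 * n + r)), rfl⟩
  refine ⟨A 0, A 1, Set.disjoint_left.2 ?_, key 0 (by norm_num), key 1 (by norm_num)⟩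
  rintro x ⟨m, hm, i, hi, rfl⟩ ⟨n, hn, j, hj, h⟩
  exact hdisj m n (by omega) i hi j hj h

open Filter in
/-- A thick set lies in an idempotent ultrafilter all of whose left multiples contain the set. -/
theorem exists_idempotent_ultrafilter {T : Type*} [Semigroup T] {A : Set T} {y : ℕ → T}
    (hy : ∀ g, ∀ᶠ n in atTop, g * y n ∈ A) :
    ∃ p : Ultrafilter T, (∀ g, ∀ᶠ x in (p : Filter T), g * x ∈ A) ∧
      ∀ s : Set T, (∀ᶠ a in (p : Filter T), ∀ᶠ b in (p : Filter T), a * b ∈ s) ↔ s ∈ p := by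
  let := @Ultrafilter.semigroup T _
  -- C is a closed subsemigroup of the ultrafilters on T, nonempty because it contains a limit of y
  -- along a free ultrafilter; the Ellis–Numakura lemma gives an idempotent in it.
  let C : Set (Ultrafilter T) := {p | ∀ g, ∀ᶠ x in (p : Filter T), g * x ∈ A}
  have hne : C.Nonempty := ⟨(hyperfilter ℕ).map y, fun g => Nat.hyperfilter_le_atTop (hy g)⟩
  have hcomp : IsCompact C := by
    have : C = ⋂ g, {p : Ultrafilter T | {x | g * x ∈ A} ∈ p} := by
      ext p; simp only [C, Set.mem_iInter]; rfl
    rw [this]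
    exact (isClosed_iInter fun g => ultrafilter_isClosed_basic _).isCompact
  obtain ⟨p, hp, hpp⟩ := exists_idempotent_in_compact_subsemigroup
    (Ultrafilter.continuous_mul_left (M := T)) C hne hcomp fun p _ q hq g => by
      rw [Ultrafilter.eventually_mul]
      refine Eventually.of_forall fun a => ?_
      filter_upwards [hq (g * a)] with b hb
      rwa [← mul_assoc]
  refine ⟨p, hp, fun s => ?_⟩
  rw [← Ultrafilter.eventually_mul, hpp]
  rfl

-- Every left translate pulls B back into q and A back into p, so B lies in pq and A in qp. As A and
-- B are disjoint, the idempotents p and q do not commute.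
open Filter in
theorem not_idempotentsCommute_of_infinite {X T : Type*} [Semigroup X] [Semigroup T] [Countable T]
    [Infinite T] [IsLeftCancelMul T] (i : T →ₙ* X) (hi : Function.Injective i) :
    ¬ IdempotentsCommute (superextension X) := by
  intro h
  obtain ⟨A, B, hAB, ⟨y, hy⟩, z, hz⟩ := exists_disjoint_thick T
  obtain ⟨p, hp, hpp⟩ := exists_idempotent_ultrafilter hy
  obtain ⟨q, hq, hqq⟩ := exists_idempotent_ultrafilter hz
  have hid : ∀ p : Ultrafilter T,
      (∀ s : Set T, (∀ᶠ a in (p : Filter T), ∀ᶠ b in (p : Filter T), a * b ∈ s) ↔ s ∈ p) →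
      ofUltrafilter (p.map i) * ofUltrafilter (p.map i) = ofUltrafilter (p.map i) := by
    intro p hpp
    ext S
    rw [mem_ofUltrafilter_mul]
    simp only [← _root_.map_mul]
    exact hpp (i ⁻¹' S)
  have hcomm := h.mul_comm_of_isMaximalLinked (isMaximalLinked_ofUltrafilter (p.map i))
    (isMaximalLinked_ofUltrafilter (q.map i)) (hid p hpp) (hid q hqq)
  have h1 : i '' B ∈ (ofUltrafilter (p.map i) * ofUltrafilter (q.map i)).sets := by
    rw [mem_ofUltrafilter_mul]
    simp only [← _root_.map_mul, hi.mem_set_image]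
    exact Eventually.of_forall hq
  have h2 : i '' A ∈ (ofUltrafilter (q.map i) * ofUltrafilter (p.map i)).sets := by
    rw [mem_ofUltrafilter_mul]
    simp only [← _root_.map_mul, hi.mem_set_image]
    exact Eventually.of_forall hp
  rw [← hcomm] at h2
  obtain ⟨x, hx, hx'⟩ := (((isMaximalLinked_ofUltrafilter (p.map i)).mul
    (isMaximalLinked_ofUltrafilter (q.map i))).1 _ h1 _ h2)
  obtain ⟨b, hb, rfl⟩ := hx
  rw [hi.mem_set_image] at hx'
  exact Set.disjoint_left.1 hAB hx' hb

open Filter in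
/-- Infinite monotone sequences of idempotents give non-commuting idempotent ultrafilters. -/
theorem not_idempotentsCommute_of_seq {X : Type*} [Semigroup X] {u : ℕ → X}
    (hu : Function.Injective u)
    (h : (∀ m n, m < n → u m * u n = u m) ∨ ∀ m n, m < n → u m * u n = u n) :
    ¬ IdempotentsCommute (superextension X) := by
  intro hc
  -- Free ultrafilters on the even (r = 0) and the odd (r = 1) indices. Being free, they see only n
  -- > m for fixed m, so each product reduces to its left factor or each to its right factor.
  let p : ℕ → Ultrafilter ℕ := fun r => (hyperfilter ℕ).map (2 * · + r)
  have hp : ∀ r m, ∀ᶠ n in (p r : Filter ℕ), m < n := by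
    intro r m
    refine Nat.hyperfilter_le_atTop ?_
    filter_upwards [eventually_gt_atTop m] with n hn
    change m < 2 * n + r
    omega
  have hpu : ∀ r, u '' {n | ∃ k, 2 * k + r = n} ∈ (ofUltrafilter ((p r).map u)).sets := by
    intro r
    change {k | u (2 * k + r) ∈ u '' {n | ∃ k, 2 * k + r = n}} ∈ hyperfilter ℕ
    simp only [hu.mem_set_image, Set.mem_ofPred_eq]
    exact Filter.Eventually.of_forall fun k => ⟨k, rfl⟩
  have hne : ofUltrafilter ((p 0).map u) ≠ ofUltrafilter ((p 1).map u) := by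
    intro h
    have h0 := hpu 0
    rw [h] at h0
    obtain ⟨x, ⟨-, ⟨m, rfl⟩, rfl⟩, -, ⟨n, rfl⟩, hx⟩ :=
      (isMaximalLinked_ofUltrafilter ((p 1).map u)).1 _ h0 _ (hpu 1)
    have := hu hx
    omega
  have hprod : (∀ r s, ofUltrafilter ((p r).map u) * ofUltrafilter ((p s).map u) =
        ofUltrafilter ((p r).map u)) ∨
      ∀ r s, ofUltrafilter ((p r).map u) * ofUltrafilter ((p s).map u) =
        ofUltrafilter ((p s).map u) := by
    refine h.imp (fun h r s => ?_) fun h r s => ?_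
    · ext S
      rw [mem_ofUltrafilter_mul]
      have : ∀ m, (∀ᶠ n in (p s : Filter ℕ), u m * u n ∈ S) ↔ u m ∈ S := fun m => by
        rw [← eventually_const (f := (p s : Filter ℕ)) (p := u m ∈ S)]
        exact eventually_congr ((hp s m).mono fun n hn => by rw [h m n hn])
      simp only [this]
      rfl
    · ext S
      rw [mem_ofUltrafilter_mul]
      have : ∀ m, (∀ᶠ n in (p s : Filter ℕ), u m * u n ∈ S) ↔ ∀ᶠ n in (p s : Filter ℕ), u n ∈ S :=
        fun m => eventually_congr ((hp s m).mono fun n hn => by rw [h m n hn])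
      simp only [this, eventually_const]
      rfl
  have hml : ∀ r, (ofUltrafilter ((p r).map u)).IsMaximalLinked :=
    fun r => isMaximalLinked_ofUltrafilter _
  rcases hprod with h | h
  · have := hc.mul_comm_of_isMaximalLinked (hml 0) (hml 1) (h 0 0) (h 1 1)
    rw [h 0 1, h 1 0] at this
    exact hne this
  · have := hc.mul_comm_of_isMaximalLinked (hml 0) (hml 1) (h 0 0) (h 1 1)
    rw [h 0 1, h 1 0] at this
    exact hne this.symm

/-! ### Regular elements of superextensions -/

/-- In a finite semigroup a cancellable element is regular. -/
theorem exists_mul_mul_eq_of_finite {S : Type*} [Semigroup S] {T K : Subsemigroup S}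
    (hT : IsCancelMul T) (hK : (K : Set S).Finite) {x : S} (hxT : x ∈ T) (hxK : x ∈ K) :
    ∃ y : S, x * y * x = x := by
  let C := T ⊓ K
  have : Finite C := (hK.subset fun x hx => hx.2 : (C : Set S).Finite)
  -- By cancellation y ↦ xyx is injective on the finite set T ∩ K, hence surjective, and so takes
  -- the value x.
  let f : C → C := fun y => ⟨x * y * x, mul_mem (mul_mem ⟨hxT, hxK⟩ y.2) ⟨hxT, hxK⟩⟩
  have hf : Function.Injective f := by
    intro y z hyz
    have h1 : x * y * x = x * z * x := congrArg Subtype.val hyz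
    have h2 : (⟨x, hxT⟩ : T) * ⟨y, y.2.1⟩ * ⟨x, hxT⟩ = (⟨x, hxT⟩ : T) * ⟨z, z.2.1⟩ * ⟨x, hxT⟩ :=
      Subtype.ext h1
    have h3 := mul_left_cancel (mul_right_cancel h2)
    exact Subtype.ext (congrArg (fun w : T => (w : S)) h3)
  obtain ⟨y, hy⟩ := Finite.surjective_of_injective hf ⟨x, hxT, hxK⟩
  exact ⟨y, congrArg Subtype.val hy⟩

namespace Upfamily

variable {X : Type*} [Semigroup X]

/-- `F` is a regular element of the semigroup of linked upfamilies. -/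
def IsLinkedRegular (F : Upfamily X) : Prop := ∃ G : Upfamily X, G.IsLinked ∧ F * G * F = F

/-- For T in F = F * (G * F), the members of G attached to a and to b intersect because G is linked.
That one u serves both points is what the obstructions exploit. -/
theorem IsLinkedRegular.exists_mem {F : Upfamily X} (h : F.IsLinkedRegular) {T : Set X}
    (hT : T ∈ F.sets) : ∃ A ∈ F.sets, ∀ a ∈ A, ∀ b ∈ A, ∃ u,
      {z | a * u * z ∈ T} ∈ F.sets ∧ {z | b * u * z ∈ T} ∈ F.sets := by
  obtain ⟨G, hG, hFG⟩ := h
  rw [← hFG, mul_assoc, mem_mul] at hT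
  refine ⟨_, hT, fun a ha b hb => ?_⟩
  rw [Set.mem_ofPred_eq, mem_mul] at ha hb
  obtain ⟨u, hu, hu'⟩ := hG _ ha _ hb
  simp only [Set.mem_ofPred_eq, ← mul_assoc] at hu hu'
  exact ⟨u, hu, hu'⟩

/-- A cancellable element is regular only with some finiteness, which K supplies: a pair of
upfamilies, the powers of a point, or everything once X is finite. -/
theorem IsMaximalLinked.isLinkedRegular
    (h : IsSubCliffordSemigroup (superextension X) ∨
      IsRegularIn (superextension X) (linkedUpfamilies X))
    {K : Subsemigroup (Upfamily X)} (hK : (K : Set (Upfamily X)).Finite)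
    {F : Upfamily X} (hF : F.IsMaximalLinked) (hFK : F ∈ K) : F.IsLinkedRegular := by
  rcases h with h | h
  · obtain ⟨T, hFT, hT⟩ := h ⟨F, hF⟩
    let K' : Subsemigroup (superextension X) := K.comap (MulMemClass.subtype (superextension X))
    have hK' : (K' : Set (superextension X)).Finite :=
      Set.Finite.preimage (f := Subtype.val) Subtype.val_injective.injOn hK
    obtain ⟨G, hG⟩ := exists_mul_mul_eq_of_finite hT hK' hFT (show _ ∈ K' from hFK)
    exact ⟨G.1, G.2.1, congrArg Subtype.val hG⟩
  · exact h F hF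

end Upfamily

open Upfamily

/-! ### Semigroups whose superextension has commuting idempotents -/

section Structure

variable {X : Type*} [Semigroup X]

theorem IdempotentsCommute.of_superextension (h : IdempotentsCommute (superextension X)) :
    IdempotentsCommute X := by
  intro e f he hf
  have := h.mul_comm_of_isMaximalLinked (isMaximalLinked_principal e) (isMaximalLinked_principal f)
    (by rw [principal_mul, he]) (by rw [principal_mul, hf])
  rw [principal_mul, principal_mul] at this
  exact principal_injective this

/-- Idempotents are pairwise comparable. -/
theorem mul_eq_left_or_right_of_idempotents (hI : IdempotentsCommute (superextension X))
    (hR : IsSubCliffordSemigroup (superextension X) ∨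
      IsRegularIn (superextension X) (linkedUpfamilies X))
    {a b : X} (ha : a * a = a) (hb : b * b = b) : a * b = a ∨ a * b = b := by
  by_contra! h
  obtain ⟨hza, hzb⟩ := h
  have hab : b * a = a * b := hI.of_superextension b a hb ha
  have h1 : a * (a * b) = a * b := by rw [← mul_assoc, ha]
  have h2 : b * (a * b) = a * b := by rw [← hab, ← mul_assoc, hb]
  have h3 : (a * b) * a = a * b := by rw [mul_assoc, hab, h1]
  have h4 : (a * b) * b = a * b := by rw [mul_assoc, hb]
  have h5 : (a * b) * (a * b) = a * b := by rw [mul_assoc, h2, h1]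
  set z := a * b with hz
  -- With z = ab, each of z, a, b is sent to z by at least two of these three right factors. Hence F
  -- * F is principal at z, and {F, z} is a two-element semigroup.
  let F := box z {a, b}
  have hF : F.IsMaximalLinked := isMaximalLinked_box z ⟨a, by simp⟩
  have hFF : F * F = principal z :=
    ((isMaximalLinked_principal z).2 _ (hF.mul hF).1 fun S (hS : z ∈ S) => by
      simp only [F, mem_mul, mem_box_pair, Set.mem_ofPred_eq, h1, h2, h3, h4, h5, ← hz, hab]
      tauto).symm
  have hFz : F * principal z = principal z :=
    ((isMaximalLinked_principal z).2 _ (hF.mul (isMaximalLinked_principal z)).1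
      fun S (hS : z ∈ S) => by
        simp only [F, mem_mul, mem_box_pair, mem_principal, Set.mem_ofPred_eq, h1, h2, h5]
        tauto).symm
  have hzF : principal z * F = principal z :=
    ((isMaximalLinked_principal z).2 _ ((isMaximalLinked_principal z).mul hF).1
      fun S (hS : z ∈ S) => by
        simp only [F, mem_mul, mem_box_pair, mem_principal, Set.mem_ofPred_eq, h3, h4, h5]
        tauto).symm
  let K : Subsemigroup (Upfamily X) :=
    { carrier := {F, principal z}
      mul_mem' := by
        rintro _ _ (rfl | rfl) (rfl | rfl)
        · exact Or.inr hFF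
        · exact Or.inr hFz
        · exact Or.inr hzF
        · exact Or.inr (by rw [principal_mul, h5]; rfl) }
  have hreg := hF.isLinkedRegular hR (K := K) ((Set.finite_singleton _).insert _) (Or.inl rfl)
  obtain ⟨A, hA, hA'⟩ := hreg.exists_mem (T := {a, b}) (by simp [F, mem_box_pair])
  have hA2 : a ∈ A ∨ b ∈ A := by
    simp only [F, mem_box_pair] at hA; tauto
  -- A value cuz in {a, b} would be fixed by right multiplication by z, so both cua and cub must lie
  -- in {a, b}. With c = a, the value cub is fixed by a on the left and by b on the right, which
  -- incomparability forbids; c = b is symmetric.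
  have key : ∀ c, c = a ∨ c = b → ∀ u, {w | c * u * w ∈ ({a, b} : Set X)} ∉ F.sets := by
    intro c hc u hu
    simp only [F, mem_box_pair, Set.mem_ofPred_eq, Set.mem_insert_iff, Set.mem_singleton_iff] at hu
    have hcc : c * c = c := by rcases hc with rfl | rfl <;> assumption
    have hl : ∀ w t, c * u * w = t → c * t = t := fun w t h => by
      rw [← h, ← mul_assoc, ← mul_assoc, hcc]
    have hr : ∀ w t, w * w = w → c * u * w = t → t * w = t := fun w t hw h => by
      rw [← h, mul_assoc, hw]
    have hcz : ∀ t, t = a ∨ t = b → c * u * z ≠ t := fun t ht h => by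
      have := hr z t h5 h
      rcases ht with rfl | rfl
      · exact hza (h1.symm.trans this)
      · exact hzb (h2.symm.trans this)
    rcases hc with rfl | rfl
    · have hcb : ∀ t, t = c ∨ t = b → c * u * b ≠ t := fun t ht h => by
        rcases ht with rfl | rfl
        · exact hza (hr _ _ hb h)
        · exact hzb (hl _ _ h)
      grind
    · have hcb : ∀ t, t = a ∨ t = c → c * u * a ≠ t := fun t ht h => by
        rcases ht with rfl | rfl
        · exact hza (hab.symm.trans (hl _ _ h))
        · exact hzb (hab.symm.trans (hr _ _ ha h))
      grind
  rcases hA2 with h | h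
  · obtain ⟨u, hu, -⟩ := hA' a h a h
    exact key a (Or.inl rfl) u hu
  · obtain ⟨u, hu, -⟩ := hA' b h b h
    exact key b (Or.inr rfl) u hu

/-- The power `x ^ (n + 1)` in a semigroup. -/
def powSucc (x : X) : ℕ → X
  | 0 => x
  | n + 1 => powSucc x n * x

theorem powSucc_mul (x : X) (m n : ℕ) : powSucc x m * powSucc x n = powSucc x (m + n + 1) := by
  induction n with
  | zero => rfl
  | succ n ih => rw [powSucc, ← mul_assoc, ih]; rfl

theorem powSucc_succ' (x : X) (n : ℕ) : powSucc x (n + 1) = x * powSucc x n := by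
  rw [show x * powSucc x n = powSucc x 0 * powSucc x n from rfl, powSucc_mul]
  congr 1; omega

/-- Distinct powers would form a copy of the positive integers under addition, an infinite countable
cancellative semigroup. -/
theorem exists_powSucc_eq (hI : IdempotentsCommute (superextension X)) (x : X) :
    ∃ i j, i < j ∧ powSucc x i = powSucc x j := by
  by_contra! h
  have hinj : Function.Injective (powSucc x) := fun i j hij => by
    rcases lt_trichotomy i j with h' | h' | h'
    exacts [(h i j h' hij).elim, h', (h j i h' hij.symm).elim]
  let i : Multiplicative ℕ+ →ₙ* X :=
    { toFun := fun n => powSucc x (PNat.natPred n.toAdd)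
      map_mul' := fun m n => by
        rw [powSucc_mul]
        congr 1
        have h1 := PNat.natPred_add_one m.toAdd
        have h2 := PNat.natPred_add_one n.toAdd
        have h3 := PNat.natPred_add_one (m * n).toAdd
        rw [toAdd_mul, PNat.add_coe] at h3
        rw [toAdd_mul]
        omega }
  have : Infinite (Multiplicative ℕ+) := inferInstanceAs (Infinite ℕ+)
  refine not_idempotentsCommute_of_infinite i (fun m n hmn => ?_) hI
  exact PNat.natPred_injective (hinj hmn)

theorem finite_range_powSucc {x : X} {i j : ℕ} (hij : i < j) (h : powSucc x i = powSucc x j) :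
    (Set.range (powSucc x)).Finite := by
  refine ((Set.finite_Iio j).image (powSucc x)).subset ?_
  rintro _ ⟨n, rfl⟩
  induction n using Nat.strong_induction_on with
  | _ n ih =>
    by_cases hn : n < j
    · exact ⟨n, hn, rfl⟩
    · rcases (not_lt.1 hn).eq_or_lt with rfl | hn'
      · exact ⟨i, hij, h⟩
      · have : powSucc x n = powSucc x (i + (n - j - 1) + 1) := by
          rw [← powSucc_mul, h, powSucc_mul]; congr 1; omega
        rw [this]
        exact ih _ (by omega)

theorem exists_mul_mul_eq (hI : IdempotentsCommute (superextension X))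
    (hR : IsSubCliffordSemigroup (superextension X) ∨
      IsRegularIn (superextension X) (linkedUpfamilies X)) (x : X) : ∃ u, x * u * x = x := by
  obtain ⟨i, j, hij, h⟩ := exists_powSucc_eq hI x
  let K : Subsemigroup (Upfamily X) :=
    { carrier := principal '' Set.range (powSucc x)
      mul_mem' := by
        rintro _ _ ⟨_, ⟨m, rfl⟩, rfl⟩ ⟨_, ⟨n, rfl⟩, rfl⟩
        exact ⟨_, ⟨m + n + 1, rfl⟩, by rw [principal_mul, powSucc_mul]⟩ }
  have hreg := (isMaximalLinked_principal x).isLinkedRegular hR (K := K)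
    ((finite_range_powSucc hij h).image _) ⟨x, ⟨0, rfl⟩, rfl⟩
  obtain ⟨A, hA, hA'⟩ := hreg.exists_mem (T := {x}) rfl
  obtain ⟨u, hu, -⟩ := hA' x hA x hA
  exact ⟨u, hu⟩

/-- A completely regular semigroup whose idempotents form a chain. -/
structure IsCliffordChain (X : Type*) [Semigroup X] : Prop where
  exists_inv : ∀ x : X, ∃ y, x * y * x = x ∧ y * x * y = y ∧ x * y = y * x
  idem_comm : ∀ e f : X, e * e = e → f * f = f → e * f = f * e
  idem_mul : ∀ e f : X, e * e = e → f * f = f → e * f = e ∨ e * f = f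

/-- The hypothesis reads x = xᵏ⁺², so xᵏ is a commuting inverse, except that k = 0 requires x
itself. -/
theorem exists_inv_of_eq_mul_powSucc {x : X} {k : ℕ} (h : x = powSucc x (k + 1)) :
    ∃ y, x * y * x = x ∧ x * y = y * x := by
  cases k with
  | zero =>
    have h' : x * x = x := h.symm
    exact ⟨x, by rw [h', h'], rfl⟩
  | succ k =>
    refine ⟨powSucc x k, ?_, ?_⟩
    · rw [← powSucc_succ', ← powSucc, ← h]
    · rw [← powSucc_succ', powSucc]

theorem isCliffordChain (hI : IdempotentsCommute (superextension X))
    (hR : IsSubCliffordSemigroup (superextension X) ∨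
      IsRegularIn (superextension X) (linkedUpfamilies X)) : IsCliffordChain X := by
  refine ⟨fun x => ?_, hI.of_superextension,
    fun e f he hf => mul_eq_left_or_right_of_idempotents hI hR he hf⟩
  suffices ∃ y, x * y * x = x ∧ x * y = y * x by
    obtain ⟨y, h1, h2⟩ := this
    refine ⟨y * x * y, ?_, ?_, ?_⟩
    · calc x * (y * x * y) * x = x * y * x * y * x := by simp only [mul_assoc]
        _ = x := by rw [h1, h1]
    · calc y * x * y * x * (y * x * y) = y * (x * y * x * y * x) * y := by simp only [mul_assoc]
        _ = y * x * y := by rw [h1, h1]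
    · calc x * (y * x * y) = x * y * x * y := by simp only [mul_assoc]
        _ = x * y := by rw [h1]
        _ = y * (x * y * x) := by rw [h1, h2]
        _ = y * x * y * x := by simp only [mul_assoc]
  obtain ⟨u, hu⟩ := exists_mul_mul_eq hI hR x
  obtain ⟨i, j, hij, h⟩ := exists_powSucc_eq hI x
  have ha : (x * u) * (x * u) = x * u := by rw [← mul_assoc, hu]
  have hb : (u * x) * (u * x) = u * x := by rw [mul_assoc, ← mul_assoc x, hu]
  have hab := hI.of_superextension _ _ ha hb
  -- Comparability of the idempotents xu and ux gives uxx = x or xxu = x, so multiplication by u on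
  -- one side lowers powers. A coincidence of two powers thereby descends to the first power.
  obtain ⟨σ, hσ⟩ : ∃ σ : X → X, ∀ n, σ (powSucc x (n + 1)) = powSucc x n := by
    rcases mul_eq_left_or_right_of_idempotents hI hR ha hb with h' | h'
    · have hx : u * x * x = x := by
        calc u * x * x = (u * x) * (x * u) * x := by rw [mul_assoc (u * x), hu]
          _ = x := by rw [← hab, h', hu]
      refine ⟨(u * ·), fun n => ?_⟩
      induction n with
      | zero => exact (mul_assoc u x x).symm.trans hx
      | succ n ih =>
        exact (mul_assoc u _ x).symm.trans (congrArg (· * x) ih)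
    · have hx : x * (x * u) = x := by
        calc x * (x * u) = x * ((u * x) * (x * u)) := by
              rw [← mul_assoc x (u * x), ← mul_assoc x u, hu]
          _ = x := by rw [← hab, h', ← mul_assoc, hu]
      refine ⟨(· * u), fun n => ?_⟩
      induction n with
      | zero => exact (mul_assoc x x u).trans hx
      | succ n ih =>
        change powSucc x (n + 2) * u = _
        rw [powSucc_succ', mul_assoc, show powSucc x (n + 1) * u = _ from ih, ← powSucc_succ']
  have : ∀ i j, i < j → powSucc x i = powSucc x j → ∃ k, x = powSucc x (k + 1) := by
    intro i
    induction i with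
    | zero => exact fun j hj h => ⟨j - 1, by rw [Nat.sub_add_cancel hj]; exact h⟩
    | succ i ih =>
      intro j hj h
      obtain ⟨j, rfl⟩ : ∃ j', j = j' + 1 := ⟨j - 1, by omega⟩
      exact ih j (by omega) (by rw [← hσ, h, hσ])
  obtain ⟨k, hk⟩ := this i j hij h
  exact exists_inv_of_eq_mul_powSucc hk

/-- `x` lies in the maximal subgroup with identity `e`. -/
def IsUnitAt (e x : X) : Prop :=
  e * x = x ∧ x * e = x ∧ ∃ y, e * y = y ∧ y * e = y ∧ x * y = e ∧ y * x = e

theorem isUnitAt_self {e : X} (he : e * e = e) : IsUnitAt e e := ⟨he, he, e, he, he, he, he⟩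

theorem IsUnitAt.idem {e x : X} (h : IsUnitAt e x) : e * e = e := by
  obtain ⟨h1, h2, y, h3, h4, h5, h6⟩ := h
  calc e * e = e * x * y := by rw [mul_assoc, h5]
    _ = e := by rw [h1, h5]

theorem IsUnitAt.mul {e x y : X} (hx : IsUnitAt e x) (hy : IsUnitAt e y) : IsUnitAt e (x * y) := by
  obtain ⟨h1, h2, w, h3, h4, h5, h6⟩ := hx
  obtain ⟨k1, k2, v, k3, k4, k5, k6⟩ := hy
  refine ⟨by rw [← mul_assoc, h1], by rw [mul_assoc, k2], v * w, by rw [← mul_assoc, k3],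
          by rw [mul_assoc, h4], ?_, ?_⟩
  · rw [mul_assoc, ← mul_assoc y, k5, h3, h5]
  · rw [mul_assoc, ← mul_assoc w, h6, k1, k6]

theorem IsUnitAt.eq_of_idem {e x : X} (hx : IsUnitAt e x) (h : x * x = x) : x = e := by
  obtain ⟨h1, h2, w, h3, h4, h5, h6⟩ := hx
  calc x = x * x * w := by rw [mul_assoc, h5, h2]
    _ = e := by rw [h, h5]

namespace IsCliffordChain

theorem exists_isUnitAt (h : IsCliffordChain X) (x : X) : ∃ e, e * e = e ∧ IsUnitAt e x := by
  obtain ⟨y, h1, h2, h3⟩ := h.exists_inv x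
  refine ⟨x * y, by rw [← mul_assoc, h1], h1, by rw [h3, ← mul_assoc, h1], y, by rw [h3, h2],
    by rw [← mul_assoc, h2], rfl, h3.symm⟩

/-- Let x lie in the group at f. If e is above f, it fixes x on both sides. If e is below f, then ye
is a right inverse of ex relative to e; this places ex in the group at e, and commuting idempotents
make ye a left inverse too, whence ex = x(ye)(ex) = xe. -/
theorem idem_central (h : IsCliffordChain X) {e : X} (he : e * e = e) (x : X) :
    e * x = x * e := by
  obtain ⟨f, hf, h1, h2, y, h3, h4, h5, h6⟩ := h.exists_isUnitAt x
  have hfe := h.idem_comm e f he hf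
  rcases h.idem_mul e f he hf with hef | hef
  · obtain ⟨k, hk, k1, k2, w, k3, k4, k5, k6⟩ := h.exists_isUnitAt (e * x)
    have e1 : e * x * (y * e) = e := by
      calc e * x * (y * e) = e * (x * y) * e := by simp only [mul_assoc]
        _ = e := by rw [h5, hef, he]
    have e2 : y * e * (e * x) * (y * e * (e * x)) = y * e * (e * x) := by
      calc y * e * (e * x) * (y * e * (e * x)) = y * e * (e * x * (y * e)) * (e * x) := by
            simp only [mul_assoc]
        _ = y * e * (e * x) := by rw [e1, mul_assoc y, he]
    have ek : e = k := by
      have a1 : k * e = e := by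
        calc k * e = k * (e * x) * (y * e) := by rw [mul_assoc, e1]
          _ = e := by rw [k1, e1]
      have a2 : e * k = k := by
        calc e * k = e * (e * x) * w := by rw [mul_assoc, k5]
          _ = k := by rw [← mul_assoc, he, k5]
      rw [← a1, ← h.idem_comm e k he hk, a2]
    have hk' : y * e * (e * x) = k := by
      have a1 : y * e * (e * x) * k = y * e * (e * x) := by rw [mul_assoc, k2]
      have a2 : k * (y * e * (e * x)) = k := by
        calc k * (y * e * (e * x)) = w * (e * x * (y * e) * (e * x)) := by
              rw [← k6]; simp only [mul_assoc]
          _ = k := by rw [e1, ← mul_assoc e, he, k6]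
      rw [← a1, ← h.idem_comm k _ hk e2, a2]
    calc e * x = (x * y) * e * x := by rw [h5, ← hfe, hef]
      _ = x * (y * e * (e * x)) := by simp only [mul_assoc]; rw [← mul_assoc e e, he]
      _ = x * e := by rw [hk', ← ek]
  · calc e * x = e * f * x := by rw [mul_assoc, h1]
      _ = x * (f * e) := by rw [hef, ← hfe, hef, h1, h2]
      _ = x * e := by rw [← mul_assoc, h2]

end IsCliffordChain

end Structure

/-! ### Finiteness of the semigroup -/

open Upfamily

section Structure

variable {X : Type*} [Semigroup X]

/-- Ramsey's theorem extracts a monotone sequence from an infinite chain of idempotents. -/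
theorem finite_idempotents (hI : IdempotentsCommute (superextension X)) (h : IsCliffordChain X) :
    {e : X | e * e = e}.Finite := by
  by_contra hinf
  let v : ℕ ↪ {e : X | e * e = e} := Set.Infinite.natEmbedding _ hinf
  have hv : ∀ n, (v n : X) * v n = v n := fun n => (v n).2
  let r : X → X → Prop := fun a b => a * b = a
  have : IsTrans X r := ⟨fun a b c (hab : a * b = a) (hbc : b * c = b) => by
    change a * c = a
    rw [← hab, mul_assoc, hbc]⟩
  obtain ⟨g, hg⟩ := exists_increasing_or_nonincreasing_subseq r (fun n => (v n : X))
  have hinj : Function.Injective fun n => (v (g n) : X) := fun m n hmn =>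
    g.injective (v.injective (Subtype.ext hmn))
  refine not_idempotentsCommute_of_seq hinj (hg.imp id fun hg m n hmn => ?_) hI
  exact (h.idem_mul _ _ (hv _) (hv _)).resolve_left (hg m n hmn)

/-- The maximal subgroup with identity `e`. -/
def UnitsAt (e : X) : Type _ := {x : X // IsUnitAt e x}

namespace UnitsAt

/-- The maximal subgroup at an idempotent is a group. -/
@[reducible]
noncomputable def group {e : X} (he : e * e = e) : Group (UnitsAt e) :=
  letI : Mul (UnitsAt e) := ⟨fun x y => ⟨x.1 * y.1, x.2.mul y.2⟩⟩
  letI : One (UnitsAt e) := ⟨⟨e, isUnitAt_self he⟩⟩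
  letI : Inv (UnitsAt e) := ⟨fun x => ⟨x.2.2.2.choose, x.2.2.2.choose_spec.1,
    x.2.2.2.choose_spec.2.1, x.1, x.2.1, x.2.2.1, x.2.2.2.choose_spec.2.2.2,
    x.2.2.2.choose_spec.2.2.1⟩⟩
  Group.ofLeftAxioms (fun x y z => Subtype.ext (mul_assoc x.1 y.1 z.1))
    (fun x => Subtype.ext x.2.1) (fun x => Subtype.ext x.2.2.2.choose_spec.2.2.2)

end UnitsAt

/-- An infinite group has an infinite countable subgroup, generated by a sequence of distinct
elements. -/
theorem finite_group_of_idempotentsCommute (hI : IdempotentsCommute (superextension X)) {H : Type*}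
    [Group H] (i : H →ₙ* X) (hi : Function.Injective i) : Finite H := by
  by_contra hH
  rw [not_finite_iff_infinite] at hH
  let f : FreeGroup ℕ →* H := FreeGroup.lift (Infinite.natEmbedding H)
  have hc : Countable f.range := Set.countable_range f
  have hinf : Infinite f.range := by
    refine Infinite.of_injective (fun n => (⟨Infinite.natEmbedding H n, FreeGroup.of n, ?_⟩ : f.range))
      fun m n hmn => ?_
    · exact FreeGroup.lift_apply_of
    · exact (Infinite.natEmbedding H).injective (congrArg Subtype.val hmn)
  let j : f.range →ₙ* X := i.comp (f.range.subtype : f.range →ₙ* H)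
  exact not_idempotentsCommute_of_infinite j (hi.comp Subtype.val_injective) hI

theorem finite_of_idempotentsCommute (hI : IdempotentsCommute (superextension X))
    (h : IsCliffordChain X) : Finite X := by
  rw [← Set.finite_univ_iff]
  refine ((finite_idempotents hI h).biUnion (t := fun e => {x | IsUnitAt e x}) fun e he => ?_).subset
    fun x _ => ?_
  · let := UnitsAt.group he
    let i : UnitsAt e →ₙ* X := ⟨Subtype.val, fun _ _ => rfl⟩
    exact finite_group_of_idempotentsCommute (H := UnitsAt e) hI i Subtype.val_injective
  · obtain ⟨e, he, hx⟩ := h.exists_isUnitAt x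
    simp only [Set.mem_iUnion]
    exact ⟨e, he, hx⟩

/-! ### Obstructions -/

/-- A box spanned by a rigid subset of a subgroup is not regular. -/
theorem not_isLinkedRegular_box_group {H : Type*} [Group H] (i : H →ₙ* X)
    (hi : Function.Injective i) {p : H} {S : Set H} (hS : S.Nontrivial) (hp : p ∉ S)
    (hT : ∀ t, (t * p ∈ S ∧ ∃ z ∈ S, t * z ∈ S) ∨ (∀ z ∈ S, t * z ∈ S) → t = 1) :
    ¬ (box (i p) (i '' S)).IsLinkedRegular := by
  intro hreg
  have hmem : ∀ A, A ∈ (box (i p) (i '' S)).sets ↔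
      (i p ∈ A ∧ ∃ z ∈ S, i z ∈ A) ∨ ∀ z ∈ S, i z ∈ A := by
    intro A
    simp only [mem_box, Set.inter_nonempty, Set.mem_image, hS.nonempty.image, true_and,
      Set.image_subset_iff]
    constructor
    · rintro (⟨h, _, h1, z, hz, rfl⟩ | h)
      exacts [Or.inl ⟨h, z, hz, h1⟩, Or.inr h]
    · rintro (⟨h, z, hz, h1⟩ | h)
      exacts [Or.inl ⟨h, _, h1, z, hz, rfl⟩, Or.inr h]
  obtain ⟨A, hA, hA'⟩ := hreg.exists_mem (T := i '' S)
    ((hmem _).2 (Or.inr fun z hz => ⟨z, hz, rfl⟩))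
  -- Every member of the box contains two distinct points of H.
  have hab : ∃ a b, a ≠ b ∧ i a ∈ A ∧ i b ∈ A := by
    rcases (hmem A).1 hA with ⟨h, z, hz, h1⟩ | h
    · exact ⟨p, z, fun h => hp (h ▸ hz), h, h1⟩
    · obtain ⟨a, ha, b, hb, hne⟩ := hS
      exact ⟨a, b, hne, h a ha, h b hb⟩
  obtain ⟨a, b, hne, ha, hb⟩ := hab
  obtain ⟨u, hu, hu'⟩ := hA' _ ha _ hb
  have hinv : ∀ m z k, m * i z = i k → m * i 1 = i (k * z⁻¹) := fun m z k h => by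
    rw [_root_.map_mul, ← h, mul_assoc, ← _root_.map_mul, mul_inv_cancel]
  -- The factor m need not lie in H, but one value in H makes it act on H as a left translation,
  -- trivial by rigidity. Applied to au and bu with the same u, this gives a⁻¹ = b⁻¹.
  have key : ∀ m : X, {z | m * z ∈ i '' S} ∈ (box (i p) (i '' S)).sets → m * i 1 = i 1 := by
    intro m hm
    have hex : ∃ t, m * i 1 = i t := by
      obtain ⟨s, hs⟩ := hS.nonempty
      rcases (hmem _).1 hm with ⟨⟨k, -, hk⟩, -⟩ | h
      · exact ⟨_, hinv _ _ _ hk.symm⟩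
      · obtain ⟨k, -, hk⟩ := h s hs
        exact ⟨_, hinv _ _ _ hk.symm⟩
    obtain ⟨t, ht⟩ := hex
    have hmt : ∀ z, m * i z ∈ i '' S ↔ t * z ∈ S := fun z => by
      rw [show m * i z = i (t * z) by rw [_root_.map_mul, ← ht, mul_assoc, ← _root_.map_mul, one_mul],
        hi.mem_set_image]
    have hm' := (hmem _).1 hm
    simp only [Set.mem_ofPred_eq, hmt] at hm'
    rw [ht, hT t hm']
  have h1 := key _ hu
  have h2 := key _ hu'
  have hinv' : ∀ c, i c * u * i 1 = i 1 → i 1 * (u * i 1) = i c⁻¹ := fun c h => by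
    have : i 1 * (u * i 1) = i c⁻¹ * (i c * u * i 1) := by
      rw [← mul_assoc, ← mul_assoc, ← mul_assoc, ← _root_.map_mul, inv_mul_cancel]
    rw [this, h, ← _root_.map_mul, mul_one]
  exact hne (inv_injective (hi ((hinv' a h1).symm.trans (hinv' b h2))))

/-- Five elements suffice for a rigid box: over {a, 1} if some a has a² ≠ 1, and otherwise over
three independent elements of an elementary abelian 2-group. -/
theorem card_group_le_four (hreg : ∀ F : Upfamily X, F.IsMaximalLinked → F.IsLinkedRegular)
    {H : Type*} [Group H] [Finite H] (i : H →ₙ* X) (hi : Function.Injective i) :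
    Nat.card H ≤ 4 := by
  classical
  by_contra! hcard
  obtain ⟨_⟩ := nonempty_fintype H
  rw [Nat.card_eq_fintype_card] at hcard
  have hex : ∀ s : Finset H, s.card ≤ 4 → ∃ c, c ∉ s := fun s hs => by
    by_contra! h
    have := Finset.card_le_card (fun x _ => h x : Finset.univ ⊆ s)
    rw [Finset.card_univ] at this
    omega
  by_cases h2 : ∃ a : H, a * a ≠ 1
  · obtain ⟨a, ha⟩ := h2
    have ha1 : a ≠ 1 := by rintro rfl; simp at ha
    -- The candidates t = a and t = a⁻¹ must send c outside {a, 1}: the first excludes c = 1 and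
    -- a⁻¹, the second a² and a.
    obtain ⟨c, hc⟩ := hex {1, a, a * a, a⁻¹} (Finset.card_le_four)
    simp only [Finset.mem_insert, Finset.mem_singleton, not_or] at hc
    obtain ⟨hc1, hca, hcaa, hcai⟩ := hc
    refine not_isLinkedRegular_box_group i hi (p := c) (S := {a, 1}) (Set.nontrivial_pair ha1)
      (by simp [hc1, hca]) ?_ (hreg _ (isMaximalLinked_box _ ⟨i a, a, by simp, rfl⟩))
    intro t ht
    simp only [Set.mem_insert_iff, Set.mem_singleton_iff, exists_eq_or_imp, exists_eq_left,
      forall_eq_or_imp, forall_eq, mul_one] at ht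
    have h3 : t = a → False := by
      rintro rfl
      have e1 : t * t ≠ t := by simpa using ha1
      have e2 : t * c ≠ t := by simpa using hc1
      have e3 : t * c ≠ 1 := fun h => hcai (eq_inv_of_mul_eq_one_right h)
      tauto
    have h4 : t * a = a → t = 1 := by simp
    have h5 : t * a = 1 → t * c ≠ a ∧ t * c ≠ 1 := by
      intro h
      obtain rfl := eq_inv_of_mul_eq_one_left h
      rw [inv_mul_eq_iff_eq_mul.ne, inv_mul_eq_iff_eq_mul.ne, mul_one]
      exact ⟨hcaa, hca⟩
    tauto
  · push Not at h2
    have hinv : ∀ x y z : H, x * y = z → x = z * y := fun x y z h => by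
      rw [← h, mul_assoc, h2, mul_one]
    have hinv' : ∀ x y z : H, x * y = z → y = x * z := fun x y z h => by
      rw [← h, ← mul_assoc, h2, one_mul]
    have hcomm : ∀ x y : H, x * y = y * x := fun x y =>
      Commute.of_orderOf_dvd_two (fun g => orderOf_dvd_of_pow_eq_one (by rw [pow_two, h2])) x y
    obtain ⟨a, ha⟩ := hex {1} (by simp)
    obtain ⟨b, hb⟩ := hex {1, a} (Finset.card_le_two.trans (by norm_num))
    obtain ⟨c, hc⟩ := hex {1, a, b, a * b} Finset.card_le_four
    simp only [Finset.mem_insert, Finset.mem_singleton, not_or] at ha hb hc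
    obtain ⟨hb1, hba⟩ := hb
    obtain ⟨hc1, hca, hcb, hcab⟩ := hc
    refine not_isLinkedRegular_box_group i hi (p := 1) (S := {a, b, c})
      ⟨a, by simp, b, by simp, Ne.symm hba⟩
      (by simp [Ne.symm ha, Ne.symm hb1, Ne.symm hc1]) ?_
      (hreg _ (isMaximalLinked_box _ ⟨i a, a, by simp, rfl⟩))
    intro t ht
    simp only [Set.mem_insert_iff, Set.mem_singleton_iff, exists_eq_or_imp, exists_eq_left,
      forall_eq_or_imp, forall_eq, mul_one] at ht
    have n1 : a * b ≠ c := fun h => hcab h.symm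
    have n2 : b * a ≠ c := fun h => n1 (by rw [hcomm, h])
    have n3 : a * c ≠ b := fun h => n1 (hinv' _ _ _ h).symm
    have n4 : c * a ≠ b := fun h => n3 (by rw [hcomm, h])
    have n5 : b * c ≠ a := fun h => n2 (hinv' _ _ _ h).symm
    have n6 : c * b ≠ a := fun h => n5 (by rw [hcomm, h])
    have m1 : ∀ x y : H, y ≠ 1 → x * y ≠ x := fun x y hy => by simpa using hy
    have m2 : ∀ x y : H, x ≠ 1 → x * y ≠ y := fun x y hx => by simpa using hx
    rcases ht with ⟨ht, ht'⟩ | ht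
    · exfalso
      rcases ht with rfl | rfl | rfl
      · simp only [h2, m1 _ _ hb1, m2 _ _ ha, m1 _ _ hc1, n1, n3, Ne.symm ha, Ne.symm hb1,
          Ne.symm hc1, or_self] at ht'
      · simp only [h2, m1 _ _ ha, m2 _ _ hb1, m1 _ _ hc1, n2, n5, Ne.symm ha, Ne.symm hb1,
          Ne.symm hc1, or_self] at ht'
      · simp only [h2, m1 _ _ hb1, m2 _ _ hc1, m1 _ _ ha, n4, n6, Ne.symm ha, Ne.symm hb1,
          Ne.symm hc1, or_self] at ht'
    · have f1 : t * a = b → t * c ≠ a := fun h h' => by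
        have := (hinv _ _ _ h).symm.trans (hinv _ _ _ h')
        rw [hcomm a c] at this
        exact hcb (mul_right_cancel this).symm
      have f2 : t * a = c → t * b ≠ a := fun h h' => by
        have := (hinv _ _ _ h).symm.trans (hinv _ _ _ h')
        rw [hcomm a b] at this
        exact hcb (mul_right_cancel this)
      have f3 : t * a = b → t * c ≠ b := fun h h' => hca (mul_left_cancel (h'.trans h.symm))
      have f4 : t * a = c → t * b ≠ c := fun h h' => hba (mul_left_cancel (h'.trans h.symm))
      have f5 : ∀ z, t * z = z → t = 1 := fun z h => by simpa using h
      rcases ht with ⟨h | h | h, h' | h' | h', h'' | h'' | h''⟩ <;>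
        first
        | exact f5 _ h
        | exact f5 _ h'
        | exact f5 _ h''
        | exact (f1 h h'').elim
        | exact (f2 h h').elim
        | exact (f3 h h'').elim
        | exact (f4 h h').elim

/-- In the majority family of f, x, y some point c of a member lies in the group at e. Then m = cu
never reaches f, so m sends two of f, x, y to x, and each choice of two collapses x, y or e. -/
theorem subsingleton_of_unit_below (hreg : ∀ F : Upfamily X, F.IsMaximalLinked → F.IsLinkedRegular)
    {e f : X} (hef : e * f = e) (hfe : f * e = e) (hne : e ≠ f) {x y : X}
    (hx : IsUnitAt e x) (hy : IsUnitAt e y) (hxe : x ≠ e) (hye : y ≠ e) : x = y := by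
  by_contra hxy
  obtain ⟨A, hA, hA'⟩ := (hreg _ (isMaximalLinked_box f ⟨x, Or.inl rfl⟩)).exists_mem
    (F := box f {x, y}) (T := {f, x}) (by simp [mem_box_pair])
  have hA2 : ∃ c ∈ A, IsUnitAt e c := by
    rcases mem_box_pair.1 hA with ⟨-, h | h⟩ | ⟨h, -⟩
    exacts [⟨x, h, hx⟩, ⟨y, h, hy⟩, ⟨x, h, hx⟩]
  obtain ⟨c, hc, hec, -⟩ := hA2
  obtain ⟨u, hu, -⟩ := hA' c hc c hc
  obtain ⟨hx1, hx2, x', hx3, hx4, hx5, hx6⟩ := hx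
  obtain ⟨hy1, hy2, y', hy3, hy4, hy5, hy6⟩ := hy
  have hcf : ∀ z, c * u * z ≠ f := fun z h => hne <| by
    rw [← hef, ← h, ← mul_assoc, ← mul_assoc, hec]
  simp only [mem_box_pair, Set.mem_ofPred_eq, Set.mem_insert_iff, Set.mem_singleton_iff, hcf,
    false_or] at hu
  generalize c * u = m at hu
  have h1 : m * x = x → m * e = e := fun h => by rw [← hx5, ← mul_assoc, h]
  have h2 : m * f = x → m * e = x := fun h => by rw [← hfe, ← mul_assoc, h, hx2]
  have h3 : m * y = m * e * y := by rw [mul_assoc, hy1]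
  rcases hu with ⟨hf, h | h⟩ | ⟨h, h'⟩
  · exact hxe ((h2 hf).symm.trans (h1 h))
  · rw [h3, h2 hf] at h
    apply hye
    rw [← hy1, ← hx6, mul_assoc, h]
  · rw [h3, h1 h, hy1] at h'
    exact hxy h'.symm

/-- The box weighs e against the set S of all non-identity elements at f. Values through e are fixed
by e and so miss S; hence a factor m must map S into S, and then mf = f, since otherwise the inverse
of mf lies in S and goes to f. A common u for x and y thus gives them the same inverse. -/
theorem subsingleton_of_unit_above (hreg : ∀ F : Upfamily X, F.IsMaximalLinked → F.IsLinkedRegular)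
    {e f : X} (hee : e * e = e) (hef : e * f = e) (hfe : f * e = e) (hne : e ≠ f) {x y : X}
    (hx : IsUnitAt f x) (hy : IsUnitAt f y) (hxf : x ≠ f) (hyf : y ≠ f) : x = y := by
  by_contra hxy
  let S : Set X := {x | IsUnitAt f x ∧ x ≠ f}
  have hSne : S.Nonempty := ⟨x, hx, hxf⟩
  obtain ⟨A, hA, hA'⟩ := (hreg _ (isMaximalLinked_box e hSne)).exists_mem
    (F := box e S) (T := S) (Or.inr ⟨hSne, subset_rfl⟩)
  have hSe : ∀ s ∈ S, e * s ≠ s ∧ s * e ≠ s := by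
    rintro s ⟨⟨-, -, s', -, -, h5, h6⟩, -⟩
    refine ⟨fun h => hne ?_, fun h => hne ?_⟩
    · rw [← hef, ← h5, ← mul_assoc, h]
    · rw [← hfe, ← h6, mul_assoc, h]
  have hSA : S ⊆ A := by
    rcases hA with ⟨h, -⟩ | ⟨-, h⟩
    · obtain ⟨u, hu, -⟩ := hA' e h e h
      obtain ⟨z, hz⟩ := (box e S).nonempty_of_mem _ hu
      exact ((hSe _ hz).1 (by simp only [← mul_assoc, hee])).elim
    · exact h
  have key : ∀ m, {z | m * z ∈ S} ∈ (box e S).sets → m * f = f := by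
    rintro m (⟨h, -⟩ | ⟨-, h⟩)
    · exact ((hSe _ h).2 (by rw [mul_assoc, hee])).elim
    · have hmf : IsUnitAt f (m * f) := by
        obtain ⟨h1, h2, x', h3, h4, h5, h6⟩ := id hx
        have := (h ⟨hx, hxf⟩ : m * x ∈ S).1.mul ⟨h3, h4, x, h1, h2, h6, h5⟩
        rwa [mul_assoc, h5] at this
      by_contra hm
      obtain ⟨h1, h2, w, h3, h4, h5, h6⟩ := hmf
      have hw : w ∈ S := ⟨⟨h3, h4, m * f, h1, h2, h6, h5⟩, fun hwf => hm (by
        rwa [hwf, h2] at h5)⟩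
      refine (h hw : m * w ∈ S).2 ?_
      rw [← h3, ← mul_assoc, h5]
  obtain ⟨u, hu, hu'⟩ := hA' x (hSA ⟨hx, hxf⟩) y (hSA ⟨hy, hyf⟩)
  have h1 := key _ hu
  have h2 := key _ hu'
  obtain ⟨hx1, hx2, x', hx3, hx4, hx5, hx6⟩ := hx
  obtain ⟨hy1, hy2, y', hy3, hy4, hy5, hy6⟩ := hy
  have hx' : x' = f * u * f := by
    calc x' = x' * (x * u * f) := by rw [h1, hx4]
      _ = x' * x * u * f := by simp only [mul_assoc]
      _ = f * u * f := by rw [hx6]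
  have hy' : y' = f * u * f := by
    calc y' = y' * (y * u * f) := by rw [h2, hy4]
      _ = y' * y * u * f := by simp only [mul_assoc]
      _ = f * u * f := by rw [hy6]
  apply hxy
  calc x = x * (y' * y) := by rw [hy6, hx2]
    _ = x * x' * y := by rw [hx', hy', ← mul_assoc]
    _ = y := by rw [hx5, hy1]

/-- In the majority family of d, g, f the point d cannot help to reach {g, f}, and m = gu cannot
reach f. So mg = mf = g, whence g² = mfg = mg = g. -/
theorem eq_of_unit_middle (hreg : ∀ F : Upfamily X, F.IsMaximalLinked → F.IsLinkedRegular)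
    {d e f g : X} (hdd : d * d = d) (hde : d * e = d) (hed : e * d = d) (hdf : d * f = d)
    (hfd : f * d = d) (hef : e * f = e) (hd : d ≠ e) (hd' : d ≠ f) (he : e ≠ f)
    (hg : IsUnitAt e g) (hfg : f * g = g) : g = e := by
  by_contra hge
  have hgid : g * g ≠ g := fun h => hge (hg.eq_of_idem h)
  obtain ⟨h1, h2, g', h3, h4, h5, h6⟩ := hg
  obtain ⟨A, hA, hA'⟩ := (hreg _ (isMaximalLinked_box d ⟨g, Or.inl rfl⟩)).exists_mem
    (F := box d {g, f}) (T := {g, f}) (by simp [mem_box_pair])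
  have hdg : d * g ≠ g := fun h => hd <| by rw [← hde, ← h5, ← mul_assoc, h]
  have hgd : g * d ≠ g := fun h => hd <| by rw [← hed, ← h6, mul_assoc, h]
  have hgA : g ∈ A := by
    rcases mem_box_pair.1 hA with ⟨h, -⟩ | ⟨h, -⟩
    · exfalso
      obtain ⟨u, hu, -⟩ := hA' d h d h
      obtain ⟨z, hz⟩ := (box d {g, f}).nonempty_of_mem _ hu
      have : d * (d * u * z) = d * u * z := by simp only [← mul_assoc, hdd]
      rcases hz with hz | hz <;> rw [hz] at this
      · exact hdg this
      · exact hd' (hdf.symm.trans this)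
    · exact h
  obtain ⟨u, hu, -⟩ := hA' g hgA g hgA
  have hmd : g * u * d ∉ ({g, f} : Set X) := by
    have : g * u * d * d = g * u * d := by rw [mul_assoc, hdd]
    rintro (hz | hz) <;> rw [hz] at this
    · exact hgd this
    · exact hd' (hfd.symm.trans this)
  have hmf : ∀ z, g * u * z ≠ f := fun z h => he <| by
    rw [← hef, ← h, ← mul_assoc, ← mul_assoc, h1]
  have h' : g * u * g = g ∧ g * u * f = g := by
    simp only [Set.mem_insert_iff, Set.mem_singleton_iff, not_or] at hmd
    simpa only [mem_box_pair, Set.mem_ofPred_eq, Set.mem_insert_iff, Set.mem_singleton_iff, hmf,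
      hmd.1, or_false, false_and, false_or] using hu
  refine hgid ?_
  calc g * g = g * u * f * g := by rw [h'.2]
    _ = g := by rw [mul_assoc, hfg, h'.1]

/-- Two points at the bottom, on which a group of order two acts trivially, give non-commuting
idempotents. -/
theorem not_idempotentsCommute_of_trivial_action {p q f g : X} (hpq : p ≠ q) (hpf : p ≠ f)
    (hpg : p ≠ g) (hqf : q ≠ f) (hfg : f ≠ g) (ff : f * f = f) (fg : f * g = g)
    (gf : g * f = g) (gg : g * g = f) (fp : f * p = p) (pf : p * f = p) (fq : f * q = q)
    (qf : q * f = q) (gp : g * p = p) (pg : p * g = p) (gq : g * q = q) (qg : q * g = q)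
    (h : p * p = p ∧ p * q = q ∧ q * p = q ∧ q * q = p ∨
      p * p = p ∧ p * q = p ∧ q * p = p ∧ q * q = q) :
    ¬ IdempotentsCommute (superextension X) := by
  intro hI
  -- The two boxes on {p, q, f, g}, weighted at p and at q, are idempotent; their two products are
  -- told apart by {p, f} and {q, f}.
  have hP := isMaximalLinked_box p (S := {q, f, g}) ⟨q, by simp⟩
  have hQ := isMaximalLinked_box q (S := {p, f, g}) ⟨p, by simp⟩
  have hPP : box p {q, f, g} * box p {q, f, g} = box p {q, f, g} := by
    refine ((hP.2 _ (hP.mul hP).1 fun S hS => ?_)).symm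
    rw [mem_mul]
    rcases h with ⟨pp, pq, qp, qq⟩ | ⟨pp, pq, qp, qq⟩ <;>
    · simp only [mem_box_triple, Set.mem_ofPred_eq, ff, fg, gf, gg, fp, pf, fq, qf, gp, pg, gq, qg,
        pp, pq, qp, qq] at hS ⊢
      generalize (p ∈ S) = P at hS ⊢
      generalize (q ∈ S) = Q at hS ⊢
      generalize (f ∈ S) = F at hS ⊢
      generalize (g ∈ S) = G at hS ⊢
      by_cases P <;> by_cases Q <;> by_cases F <;> by_cases G <;> simp_all
  have hQQ : box q {p, f, g} * box q {p, f, g} = box q {p, f, g} := by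
    refine ((hQ.2 _ (hQ.mul hQ).1 fun S hS => ?_)).symm
    rw [mem_mul]
    rcases h with ⟨pp, pq, qp, qq⟩ | ⟨pp, pq, qp, qq⟩ <;>
    · simp only [mem_box_triple, Set.mem_ofPred_eq, ff, fg, gf, gg, fp, pf, fq, qf, gp, pg, gq, qg,
        pp, pq, qp, qq] at hS ⊢
      generalize (p ∈ S) = P at hS ⊢
      generalize (q ∈ S) = Q at hS ⊢
      generalize (f ∈ S) = F at hS ⊢
      generalize (g ∈ S) = G at hS ⊢
      by_cases P <;> by_cases Q <;> by_cases F <;> by_cases G <;> simp_all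
  have hc := hI.mul_comm_of_isMaximalLinked hP hQ hPP hQQ
  have hS : ∀ S, S ∈ (box p {q, f, g} * box q {p, f, g}).sets ↔
      S ∈ (box q {p, f, g} * box p {q, f, g}).sets := fun S => by rw [hc]
  rcases h with ⟨pp, pq, qp, qq⟩ | ⟨pp, pq, qp, qq⟩ <;>
  · simp only [mem_mul, mem_box_triple, Set.mem_ofPred_eq, ff, fg, gf, gg, fp, pf, fq, qf, gp, pg, gq, qg,
        pp, pq, qp, qq] at hS
    have a1 := hS {p, f}
    have a2 := hS {q, f}
    simp [hpq.symm, hpf, hpf.symm, hpg.symm, hqf, hfg.symm] at a1 a2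

end Structure

/-! ### Recognition of the exceptional semigroups -/

open Upfamily

section Classification

variable {X : Type*} [Semigroup X]

theorem exists_mulEquiv_linSemilattice [Finite X] (hc : ∀ x y : X, x * y = y * x)
    (h : ∀ x y : X, x * y = x ∨ x * y = y) : ∃ n, Nonempty (X ≃* LinSemilattice n) := by
  classical
  obtain ⟨_⟩ := nonempty_fintype X
  have hid : ∀ x : X, x * x = x := fun x => (h x x).elim id id
  let : LinearOrder X :=
    { le := fun x y => x * y = x
      le_refl := hid
      le_trans := fun x y z (hxy : x * y = x) (hyz : y * z = y) => by
        rw [← hxy, mul_assoc, hyz]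
      le_antisymm := fun x y (hxy : x * y = x) (hyx : y * x = y) => by
        rw [← hxy, hc, hyx]
      le_total := fun x y => (h x y).imp id fun hxy => (hc y x).trans hxy
      toDecidableLE := Classical.decRel _ }
  have hle : ∀ x y : X, x ≤ y ↔ x * y = x := fun _ _ => Iff.rfl
  have hmin : ∀ x y : X, x * y = min x y := fun x y => by
    rcases le_total x y with hxy | hxy
    · rw [min_eq_left hxy, (hle x y).1 hxy]
    · rw [min_eq_right hxy, hc, (hle y x).1 hxy]
  let e := Fintype.orderIsoFinOfCardEq X rfl
  refine ⟨Fintype.card X, ⟨⟨e.symm.toEquiv, fun x y => ?_⟩⟩⟩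
  rw [hmin]
  exact e.symm.monotone.map_min

/-- The homomorphism from the cyclic group of order two given by its two values. -/
def cyclicGrpTwoHom {e g : X} (ee : e * e = e) (eg : e * g = g) (ge : g * e = g)
    (gg : g * g = e) : CyclicGrp 2 →ₙ* X where
  toFun c := if c = 1 then e else g
  map_mul' c d := by
    have h1 : Multiplicative.ofAdd (1 : ZMod 2) ≠ 1 := by decide
    have h2 : Multiplicative.ofAdd (1 : ZMod 2) * Multiplicative.ofAdd (1 : ZMod 2) = 1 := by decide
    rcases cyclicGrp_two_eq c with rfl | rfl <;> rcases cyclicGrp_two_eq d with rfl | rfl <;>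
      simp [h1, h2, ee, eg, ge, gg]

section TwoHom

variable {e g : X} (ee : e * e = e) (eg : e * g = g) (ge : g * e = g) (gg : g * g = e)

theorem cyclicGrpTwoHom_one : cyclicGrpTwoHom ee eg ge gg 1 = e := by
  change (if (1 : CyclicGrp 2) = 1 then e else g) = e
  exact if_pos rfl

theorem cyclicGrpTwoHom_ofAdd_one : cyclicGrpTwoHom ee eg ge gg (Multiplicative.ofAdd 1) = g := by
  change (if (Multiplicative.ofAdd 1 : CyclicGrp 2) = 1 then e else g) = g
  exact if_neg (by decide)

theorem cyclicGrpTwoHom_mem (c : CyclicGrp 2) :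
    cyclicGrpTwoHom ee eg ge gg c = e ∨ cyclicGrpTwoHom ee eg ge gg c = g := by
  rcases cyclicGrp_two_eq c with rfl | rfl
  exacts [Or.inl (cyclicGrpTwoHom_one ..), Or.inr (cyclicGrpTwoHom_ofAdd_one ..)]

theorem cyclicGrpTwoHom_injective (hne : e ≠ g) :
    Function.Injective (cyclicGrpTwoHom ee eg ge gg) := by
  intro c d h
  rcases cyclicGrp_two_eq c with rfl | rfl <;> rcases cyclicGrp_two_eq d with rfl | rfl <;>
    simp only [cyclicGrpTwoHom_one, cyclicGrpTwoHom_ofAdd_one] at h <;>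
    first | rfl | exact (hne h).elim | exact (hne h.symm).elim

end TwoHom

/-- Gluing two homomorphisms to one of the disjoint ordered union. -/
def OrderedUnion.lift {Y Z : Type*} [Semigroup Y] [Semigroup Z] (i : Y →ₙ* X) (j : Z →ₙ* X)
    (h : ∀ y z, i y * j z = i y) (h' : ∀ y z, j z * i y = i y) : OrderedUnion Y Z →ₙ* X where
  toFun := Sum.elim i j
  map_mul' := by
    rintro (x | x) (y | y)
    · exact map_mul i x y
    · exact (h x y).symm
    · exact (h' y x).symm
    · exact map_mul j x y

theorem OrderedUnion.nonempty_mulEquiv {Y Z : Type*} [Semigroup Y] [Semigroup Z] (i : Y →ₙ* X)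
    (j : Z →ₙ* X) (h : ∀ y z, i y * j z = i y) (h' : ∀ y z, j z * i y = i y)
    (hi : Function.Injective i) (hj : Function.Injective j) (hij : ∀ y z, i y ≠ j z)
    (hs : ∀ x, (∃ y, i y = x) ∨ ∃ z, j z = x) : Nonempty (X ≃* OrderedUnion Y Z) := by
  refine ⟨(MulEquiv.ofBijective (OrderedUnion.lift i j h h') ⟨?_, fun x => ?_⟩).symm⟩
  · exact hi.sumElim hj hij
  · rcases hs x with ⟨y, hy⟩ | ⟨z, hz⟩
    exacts [⟨Sum.inl y, hy⟩, ⟨Sum.inr z, hz⟩]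

theorem exists_mulEquiv_two_orderedUnion [Finite X] {e g : X} (hne : e ≠ g) (ee : e * e = e)
    (eg : e * g = g) (ge : g * e = g) (gg : g * g = e)
    (hc : ∀ x y : X, x ≠ e → x ≠ g → y ≠ e → y ≠ g → x * y = y * x ∧ (x * y = x ∨ x * y = y))
    (he : ∀ x, x ≠ e → x ≠ g → e * x = e ∧ x * e = e) :
    ∃ n, Nonempty (X ≃* OrderedUnion (CyclicGrp 2) (LinSemilattice n)) := by
  let Y : Subsemigroup X :=
    { carrier := {x | x ≠ e ∧ x ≠ g}
      mul_mem' := fun {x y} hx hy => by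
        rcases (hc x y hx.1 hx.2 hy.1 hy.2).2 with h | h <;> rw [h] <;> assumption }
  obtain ⟨n, ⟨φ⟩⟩ := exists_mulEquiv_linSemilattice (X := Y)
    (fun x y => Subtype.ext (hc x y x.2.1 x.2.2 y.2.1 y.2.2).1)
    fun x y => (hc x y x.2.1 x.2.2 y.2.1 y.2.2).2.imp Subtype.ext Subtype.ext
  have hg : ∀ x, x ≠ e → x ≠ g → g * x = g ∧ x * g = g := fun x h1 h2 =>
    ⟨by rw [← ge, mul_assoc, (he x h1 h2).1], by rw [← eg, ← mul_assoc, (he x h1 h2).2]⟩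
  let i := cyclicGrpTwoHom ee eg ge gg
  let j : LinSemilattice n →ₙ* X := (MulMemClass.subtype Y).comp (φ.symm : LinSemilattice n →ₙ* Y)
  have hj : ∀ z, j z ≠ e ∧ j z ≠ g := fun z => (φ.symm z).2
  have hi : ∀ y, i y = e ∨ i y = g := cyclicGrpTwoHom_mem ee eg ge gg
  refine ⟨n, OrderedUnion.nonempty_mulEquiv i j (fun y z => ?_) (fun y z => ?_)
    (cyclicGrpTwoHom_injective ee eg ge gg hne) (Subtype.val_injective.comp φ.symm.injective)
    (fun y z h => ?_) fun x => ?_⟩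
  · rcases hi y with h | h <;> rw [h]
    exacts [(he _ (hj z).1 (hj z).2).1, (hg _ (hj z).1 (hj z).2).1]
  · rcases hi y with h | h <;> rw [h]
    exacts [(he _ (hj z).1 (hj z).2).2, (hg _ (hj z).1 (hj z).2).2]
  · rcases hi y with h' | h' <;> rw [h'] at h
    exacts [(hj z).1 h.symm, (hj z).2 h.symm]
  · by_cases hxe : x = e
    · exact Or.inl ⟨1, (cyclicGrpTwoHom_one ..).trans hxe.symm⟩
    by_cases hxg : x = g
    · exact Or.inl ⟨_, (cyclicGrpTwoHom_ofAdd_one ..).trans hxg.symm⟩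
    · exact Or.inr ⟨φ ⟨x, hxe, hxg⟩, congrArg Subtype.val (φ.symm_apply_apply _)⟩

theorem nonempty_mulEquiv_one_orderedUnion {e f g : X} (hfg : f ≠ g) (hef : e ≠ f) (heg : e ≠ g)
    (hx : ∀ x, x = e ∨ x = f ∨ x = g) (ee : e * e = e) (ff : f * f = f) (fg : f * g = g)
    (gf : g * f = g) (gg : g * g = f) (hf : e * f = e ∧ f * e = e) (hg : e * g = e ∧ g * e = e) :
    Nonempty (X ≃* OrderedUnion (LinSemilattice 1) (CyclicGrp 2)) := by
  let j := cyclicGrpTwoHom ff fg gf gg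
  have hj : ∀ y, j y = f ∨ j y = g := cyclicGrpTwoHom_mem ff fg gf gg
  refine OrderedUnion.nonempty_mulEquiv ⟨fun _ => e, fun _ _ => ee.symm⟩ j (fun y z => ?_)
    (fun y z => ?_) (fun a b _ => Subsingleton.elim (α := Fin 1) a b)
    (cyclicGrpTwoHom_injective ff fg gf gg hfg) (fun y z h => ?_) fun x => ?_
  · rcases hj z with h | h <;> rw [h]
    exacts [hf.1, hg.1]
  · rcases hj z with h | h <;> rw [h]
    exacts [hf.2, hg.2]
  · rcases hj z with h' | h' <;> rw [h'] at h
    exacts [hef h, heg h]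
  · rcases hx x with rfl | rfl | rfl
    exacts [Or.inl ⟨(0 : Fin 1), rfl⟩, Or.inr ⟨1, cyclicGrpTwoHom_one ..⟩,
      Or.inr ⟨_, cyclicGrpTwoHom_ofAdd_one ..⟩]

theorem nonempty_mulEquiv_linSemilattice_two_prod {f g e : X} (hfg : f ≠ g) (hne : e ≠ g * e)
    (hx : ∀ x, x = e ∨ x = g * e ∨ x = f ∨ x = g) (he : ∀ x, e * x = x * e) (ee : e * e = e)
    (ef : e * f = e) (hef : e ≠ f) (ff : f * f = f) (fg : f * g = g) (gf : g * f = g)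
    (gg : g * g = f) : Nonempty (X ≃* LinSemilattice 2 × CyclicGrp 2) := by
  let j := cyclicGrpTwoHom ff fg gf gg
  obtain ⟨z, w, hzw, k, hkz, hkw⟩ : ∃ z w : LinSemilattice 2, (∀ a, a = z ∨ a = w) ∧
      ∃ k : LinSemilattice 2 →ₙ* X, k z = e ∧ k w = f := by
    refine ⟨(0 : Fin 2), (1 : Fin 2), (by decide : ∀ a : Fin 2, a = 0 ∨ a = 1),
      ⟨fun i : Fin 2 => if i = 0 then e else f, ?_⟩, rfl, rfl⟩
    have fe : f * e = e := by rw [← he, ef]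
    change ∀ x y : Fin 2, (if min x y = 0 then e else f) = (if x = 0 then e else f) * _
    simp [Fin.forall_fin_two, ee, ef, fe, ff]
  have hj1 : j 1 = f := cyclicGrpTwoHom_one ..
  have hjg : j (Multiplicative.ofAdd 1) = g := cyclicGrpTwoHom_ofAdd_one ..
  have hcomm : ∀ a b, k a * j b = j b * k a := by
    intro a b
    rcases hzw a with rfl | rfl
    · rw [hkz, he]
    · rcases cyclicGrp_two_eq b with rfl | rfl <;> simp only [hkw, hj1, hjg, fg, gf]
  let φ : LinSemilattice 2 × CyclicGrp 2 →ₙ* X :=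
    { toFun := fun x => k x.1 * j x.2
      map_mul' := fun x y => by
        rw [Prod.fst_mul, Prod.snd_mul, _root_.map_mul, _root_.map_mul, mul_assoc,
          ← mul_assoc (k y.1), hcomm, mul_assoc, mul_assoc] }
  have h00 : φ (z, 1) = e := by
    change k z * j 1 = e
    rw [hkz, hj1, ef]
  have h01 : φ (z, Multiplicative.ofAdd 1) = g * e := by
    change k z * j (Multiplicative.ofAdd 1) = _
    rw [hkz, hjg, he]
  have h10 : φ (w, 1) = f := by
    change k w * j 1 = f
    rw [hkw, hj1, ff]
  have h11 : φ (w, Multiplicative.ofAdd 1) = g := by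
    change k w * j (Multiplicative.ofAdd 1) = _
    rw [hkw, hjg, fg]
  have hne2 : e ≠ g := fun h => hne (by rw [← h, ee])
  have hne3 : g * e ≠ f := fun h => hef (by
    rw [← ef, ← h, he, mul_assoc, ee, h])
  have hne4 : g * e ≠ g := fun h => hef (by
    have : g * (g * e) = g * g := by rw [h]
    rwa [← mul_assoc, gg, ← he, ef] at this)
  refine ⟨(MulEquiv.ofBijective φ ⟨?_, fun x => ?_⟩).symm⟩
  · rintro ⟨a, b⟩ ⟨c, d⟩ h
    rcases hzw a with rfl | rfl <;> rcases hzw c with rfl | rfl <;>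
      rcases cyclicGrp_two_eq b with rfl | rfl <;> rcases cyclicGrp_two_eq d with rfl | rfl <;>
      simp only [h00, h01, h10, h11] at h <;> grind
  · rcases hx x with rfl | rfl | rfl | rfl
    exacts [⟨_, h00⟩, ⟨_, h01⟩, ⟨_, h10⟩, ⟨_, h11⟩]

theorem nonempty_mulEquiv_of_card_le_four {H : Type*} [Group H] [Finite H] (h : Nat.card H ≤ 4) :
    Nonempty (H ≃* CyclicGrp 2) ∨ Nonempty (H ≃* CyclicGrp 3) ∨ Nonempty (H ≃* CyclicGrp 4) ∨
      Nonempty (H ≃* CyclicGrp 2 × CyclicGrp 2) ∨ Nonempty (H ≃* LinSemilattice 1) := by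
  have hpos : 0 < Nat.card H := Nat.card_pos
  have hc : ∀ n, Nat.card (CyclicGrp n) = n := fun n => Nat.card_zmod n
  obtain h1 | h2 | h3 | h4 : Nat.card H = 1 ∨ Nat.card H = 2 ∨ Nat.card H = 3 ∨ Nat.card H = 4 := by
    omega
  · have := (Nat.card_eq_one_iff_unique.1 h1).1
    refine Or.inr (Or.inr (Or.inr (Or.inr ⟨⟨⟨fun _ => (0 : Fin 1), fun _ => 1,
      fun _ => Subsingleton.elim _ _, fun x => Subsingleton.elim (α := Fin 1) _ x⟩,
      fun _ _ => rfl⟩⟩)))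
  · have : Fact (Nat.Prime 2) := ⟨Nat.prime_two⟩
    exact Or.inl ⟨mulEquivOfPrimeCardEq h2 (hc 2)⟩
  · have : Fact (Nat.Prime 3) := ⟨Nat.prime_three⟩
    exact Or.inr (Or.inl ⟨mulEquivOfPrimeCardEq h3 (hc 3)⟩)
  · by_cases hcyc : IsCyclic H
    · exact Or.inr (Or.inr (Or.inl ⟨mulEquivOfCyclicCardEq (h4.trans (hc 4).symm)⟩))
    · have hexp : Monoid.exponent H = 2 :=
        (not_isCyclic_iff_exponent_eq_prime Nat.prime_two (by rw [h4]; rfl)).1 hcyc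
      have : IsKleinFour H := ⟨h4, hexp⟩
      have : IsKleinFour (CyclicGrp 2 × CyclicGrp 2) := by
        refine ⟨by rw [Nat.card_prod, hc], ?_⟩
        rw [Monoid.exponent_prod, (isCyclic_of_prime_card (hc 2)).exponent_eq_card, hc]
        rfl
      exact Or.inr (Or.inr (Or.inr (Or.inl (IsKleinFour.nonempty_mulEquiv))))

/-! ### Case analysis along the chain of idempotents -/

theorem exists_bottom_idempotent [Finite X] [Nonempty X] (h : IsCliffordChain X) :
    ∃ e : X, e * e = e ∧ ∀ f, f * f = f → e * f = e := by
  classical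
  obtain ⟨_⟩ := nonempty_fintype X
  obtain ⟨e₀, he₀, -⟩ := h.exists_isUnitAt (Classical.arbitrary X)
  have : ∀ s : Finset X, ∃ e : X, e * e = e ∧ ∀ f ∈ s, f * f = f → e * f = e := by
    intro s
    induction s using Finset.induction_on with
    | empty => exact ⟨e₀, he₀, by simp⟩
    | insert a s _ ih =>
      obtain ⟨e, he, hs⟩ := ih
      by_cases ha : a * a = a
      · refine ⟨e * a, ?_, fun f hf hff => ?_⟩
        · rw [mul_assoc, ← mul_assoc a, ← h.idem_comm e a he ha, mul_assoc e a a, ha, ← mul_assoc, he]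
        · rcases Finset.mem_insert.1 hf with rfl | hf
          · rw [mul_assoc, ha]
          · rw [h.idem_comm e a he ha, mul_assoc, hs f hf hff]
      · refine ⟨e, he, fun f hf hff => ?_⟩
        rcases Finset.mem_insert.1 hf with rfl | hf
        exacts [(ha hff).elim, hs f hf hff]
  obtain ⟨e, he, hs⟩ := this Finset.univ
  exact ⟨e, he, fun f => hs f (Finset.mem_univ f)⟩

/-- Multiplication by a lower idempotent is the structure map between the maximal subgroups. -/
theorem IsUnitAt.mul_idem (h : IsCliffordChain X) {f e g : X} (hg : IsUnitAt f g)
    (he : e * e = e) (hfe : f * e = e) : IsUnitAt e (g * e) := by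
  obtain ⟨h1, h2, y, h3, h4, h5, h6⟩ := hg
  have hc := h.idem_central he
  refine ⟨by rw [← mul_assoc, hc, mul_assoc, he], by rw [mul_assoc, he], y * e,
    by rw [← mul_assoc, hc, mul_assoc, he], by rw [mul_assoc, he], ?_, ?_⟩
  · rw [mul_assoc, ← mul_assoc e, hc, mul_assoc, he, ← mul_assoc, h5, hfe]
  · rw [mul_assoc, ← mul_assoc e, hc, mul_assoc, he, ← mul_assoc, h6, hfe]

/-- The semigroups whose superextension is a commutative Clifford semigroup. -/
def IsExceptional (X : Type*) [Semigroup X] : Prop :=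
  Nonempty (X ≃* CyclicGrp 2) ∨
    Nonempty (X ≃* CyclicGrp 3) ∨
    Nonempty (X ≃* CyclicGrp 4) ∨
    Nonempty (X ≃* CyclicGrp 2 × CyclicGrp 2) ∨
    Nonempty (X ≃* LinSemilattice 2 × CyclicGrp 2) ∨
    Nonempty (X ≃* OrderedUnion (LinSemilattice 1) (CyclicGrp 2)) ∨
    (∃ n : ℕ, Nonempty (X ≃* LinSemilattice n)) ∨
    ∃ n : ℕ, Nonempty (X ≃* OrderedUnion (CyclicGrp 2) (LinSemilattice n))

theorem IsExceptional.commRegularSuperextension (h : IsExceptional X) :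
    CommRegularSuperextension X := by
  rcases h with ⟨⟨e⟩⟩ | ⟨⟨e⟩⟩ | ⟨⟨e⟩⟩ | ⟨⟨e⟩⟩ | ⟨⟨e⟩⟩ | ⟨⟨e⟩⟩ | ⟨n, ⟨e⟩⟩ | ⟨n, ⟨e⟩⟩
  -- C₂ is C₂ ⊔ L₀.
  · have hL : IsEmpty (LinSemilattice 0) := inferInstanceAs (IsEmpty (Fin 0))
    refine (commRegularSuperextension_two_orderedUnion 0).of_mulEquiv (e.trans
      (MulEquiv.mk (Equiv.sumEmpty _ (LinSemilattice 0)).symm fun _ _ => rfl))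
  · exact commRegularSuperextension_cyclicGrp_three.of_mulEquiv e
  · exact commRegularSuperextension_cyclicGrp_four.of_mulEquiv e
  · exact commRegularSuperextension_cyclicGrp_two_prod.of_mulEquiv e
  · exact commRegularSuperextension_linSemilattice_two_prod.of_mulEquiv e
  · exact commRegularSuperextension_one_orderedUnion.of_mulEquiv e
  · exact (commRegularSuperextension_linSemilattice n).of_mulEquiv e
  · exact (commRegularSuperextension_two_orderedUnion n).of_mulEquiv e

theorem isExceptional_of_group (hreg : ∀ F : Upfamily X, F.IsMaximalLinked → F.IsLinkedRegular)
    [Finite X] {e : X} (he : e * e = e) (h : ∀ x, IsUnitAt e x) : IsExceptional X := by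
  let := UnitsAt.group he
  let i : UnitsAt e →ₙ* X := ⟨Subtype.val, fun _ _ => rfl⟩
  have hi : Function.Injective i := Subtype.val_injective
  have : Finite (UnitsAt e) := Finite.of_injective i hi
  let φ : X ≃* UnitsAt e := (MulEquiv.ofBijective i ⟨hi, fun x => ⟨⟨x, h x⟩, rfl⟩⟩).symm
  rcases nonempty_mulEquiv_of_card_le_four (card_group_le_four hreg i hi) with
    ⟨⟨ψ⟩⟩ | ⟨⟨ψ⟩⟩ | ⟨⟨ψ⟩⟩ | ⟨⟨ψ⟩⟩ | ⟨⟨ψ⟩⟩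
  · exact Or.inl ⟨φ.trans ψ⟩
  · exact Or.inr (Or.inl ⟨φ.trans ψ⟩)
  · exact Or.inr (Or.inr (Or.inl ⟨φ.trans ψ⟩))
  · exact Or.inr (Or.inr (Or.inr (Or.inl ⟨φ.trans ψ⟩)))
  · exact Or.inr (Or.inr (Or.inr (Or.inr (Or.inr (Or.inr (Or.inl ⟨1, ⟨φ.trans ψ⟩⟩))))))

/-- Let e be the least idempotent. With no other idempotent, X is a group of order at most 4.
Otherwise the group at e has order at most 2; if all higher groups are trivial, X is Lₙ or C₂ ⊔ Lₙ.
A nontrivial higher group {f, g} leaves no third idempotent, and the group at e decides between L₂ ×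
C₂ and L₁ ⊔ C₂. -/
theorem isExceptional_of_isCliffordChain (hI : IdempotentsCommute (superextension X))
    (hreg : ∀ F : Upfamily X, F.IsMaximalLinked → F.IsLinkedRegular) [Finite X]
    (h : IsCliffordChain X) : IsExceptional X := by
  rcases isEmpty_or_nonempty X with hX | hX
  · exact Or.inr (Or.inr (Or.inr (Or.inr (Or.inr (Or.inr (Or.inl
      (exists_mulEquiv_linSemilattice (fun x => hX.elim x) fun x => hX.elim x)))))))
  obtain ⟨e, he, hbot⟩ := exists_bottom_idempotent h
  have hbot' : ∀ f, f * f = f → f * e = e := fun f hf => by rw [h.idem_comm f e hf he, hbot f hf]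
  by_cases hE : ∀ f : X, f * f = f → f = e
  · refine isExceptional_of_group hreg he fun x => ?_
    obtain ⟨f, hf, hx⟩ := h.exists_isUnitAt x
    rwa [hE f hf] at hx
  push Not at hE
  obtain ⟨f₀, hf₀, hne₀⟩ := hE
  have hbelow : ∀ x y, IsUnitAt e x → IsUnitAt e y → x ≠ e → y ≠ e → x = y := fun x y =>
    subsingleton_of_unit_below hreg (hbot f₀ hf₀) (hbot' f₀ hf₀) hne₀.symm
  by_cases htriv : ∀ f x, f * f = f → f ≠ e → IsUnitAt f x → x = f
  · have hid : ∀ x, ¬ IsUnitAt e x → x * x = x := fun x hx => by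
      obtain ⟨f, hf, hxf⟩ := h.exists_isUnitAt x
      have hfe : f ≠ e := fun h => hx (h ▸ hxf)
      rwa [htriv f x hf hfe hxf]
    by_cases hunit : ∃ g, IsUnitAt e g ∧ g ≠ e
    · obtain ⟨g, hg, hge⟩ := hunit
      have hgg : g * g = e := by
        by_contra hgg
        exact hge (hg.eq_of_idem (hbelow _ _ (hg.mul hg) hg hgg hge))
      have hid' : ∀ x, x ≠ e → x ≠ g → x * x = x := fun x hxe hxg =>
        hid x fun hx => hxg (hbelow x g hx hg hxe hge)
      exact Or.inr (Or.inr (Or.inr (Or.inr (Or.inr (Or.inr (Or.inr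
        (exists_mulEquiv_two_orderedUnion hge.symm he hg.1 hg.2.1 hgg
          (fun x y h1 h2 h3 h4 => ⟨h.idem_comm x y (hid' x h1 h2) (hid' y h3 h4),
            h.idem_mul x y (hid' x h1 h2) (hid' y h3 h4)⟩)
          fun x h1 h2 => ⟨hbot x (hid' x h1 h2), hbot' x (hid' x h1 h2)⟩)))))))
    · push Not at hunit
      have hid' : ∀ x : X, x * x = x := fun x => by
        by_cases hx : IsUnitAt e x
        · rw [hunit x hx, he]
        · exact hid x hx
      exact Or.inr (Or.inr (Or.inr (Or.inr (Or.inr (Or.inr (Or.inl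
        (exists_mulEquiv_linSemilattice (fun x y => h.idem_comm x y (hid' x) (hid' y))
          fun x y => h.idem_mul x y (hid' x) (hid' y))))))))
  push Not at htriv
  obtain ⟨f, g, hf, hfe, hg, hgf⟩ := htriv
  have habove : ∀ x y, IsUnitAt f x → IsUnitAt f y → x ≠ f → y ≠ f → x = y := fun x y =>
    subsingleton_of_unit_above hreg he (hbot f hf) (hbot' f hf) hfe.symm
  have hgg : g * g = f := by
    by_contra hgg
    exact hgf (hg.eq_of_idem (habove _ _ (hg.mul hg) hg hgg hgf))
  have hgid : ∀ x, x * x = x → x ≠ g := fun x hx hxg =>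
    hgf (hg.eq_of_idem (hxg ▸ hx))
  have hnot : ∀ p q : X, p ≠ q → p * p = p → p ≠ f → q ≠ f → q ≠ g → g * p = p → g * q = q →
      f * q = q → q * f = q → q * g = q →
      (p * q = q ∧ q * p = q ∧ q * q = p ∨ p * q = p ∧ q * p = p ∧ q * q = q) → p * f = p →
      f * p = p → False :=
    fun p q hpq hpp hpf hqf hqg gp gq fq qf qg hm pf fp =>
      not_idempotentsCommute_of_trivial_action hpq hpf (hgid p hpp) hqf hgf.symm hf hg.1 hg.2.1 hgg
        fp pf fq qf gp (by rw [h.idem_central hpp, gp]) gq qg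
        (hm.imp (fun hm => ⟨hpp, hm⟩) fun hm => ⟨hpp, hm⟩) hI
  have hE : ∀ k : X, k * k = k → k = e ∨ k = f := by
    intro k hk
    by_contra! hne
    obtain ⟨hke, hkf⟩ := hne
    -- If k is above f, the group at f is a middle one, so g = f. If k is between e and f, then gk
    -- lies in a middle group, so g fixes k and e: a trivial action on the chain e < k.
    rcases h.idem_mul f k hf hk with hfk | hfk
    · exact hgf (eq_of_unit_middle hreg he (hbot f hf) (hbot' f hf) (hbot k hk) (hbot' k hk) hfk
        hfe.symm hke.symm hkf.symm hg (by rw [← hg.1, ← mul_assoc, h.idem_comm k f hk hf, hfk]))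
    · have hkf' : k * f = k := by rw [h.idem_comm k f hk hf, hfk]
      have hgk : g * k = k := eq_of_unit_middle hreg he (hbot k hk) (hbot' k hk) (hbot f hf)
        (hbot' f hf) hkf' hke.symm hfe.symm hkf (hg.mul_idem h hk hfk)
        (by rw [← mul_assoc, hg.1])
      have hge : g * e = e := by rw [← hbot' k hk, ← mul_assoc, hgk]
      exact hnot e k hke.symm he hfe.symm hkf (hgid k hk) hge hgk hfk hkf'
        (by rw [h.idem_central hk, hgk]) (Or.inr ⟨hbot k hk, hbot' k hk, hk⟩) (hbot f hf)
        (hbot' f hf)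
  have hx : ∀ x, IsUnitAt e x ∨ x = f ∨ x = g := by
    intro x
    obtain ⟨k, hk, hxk⟩ := h.exists_isUnitAt x
    rcases hE k hk with rfl | rfl
    · exact Or.inl hxk
    · by_cases hxf : x = k
      · exact Or.inr (Or.inl hxf)
      · exact Or.inr (Or.inr (habove x g hxk hg hxf hgf))
  by_cases hunit : ∃ k, IsUnitAt e k ∧ k ≠ e
  · obtain ⟨k, hk, hke⟩ := hunit
    -- If ge = e, then g would act trivially on the group {e, k} of order two.
    have hge : g * e ≠ e := by
      intro hge
      have hkk : k * k = e := by
        by_contra hkk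
        exact hke (hk.eq_of_idem (hbelow _ _ (hk.mul hk) hk hkk hke))
      have hfk : f * k = k := by rw [← hk.1, ← mul_assoc, hbot' f hf]
      have hkf : k * f = k := by rw [← hk.2.1, mul_assoc, hbot f hf]
      have hgk : g * k = k := by rw [← hk.1, ← mul_assoc, hge]
      have heg : e * g = e := by rw [h.idem_central he, hge]
      have hkg : k * g = k := by rw [← hk.2.1, mul_assoc, heg]
      have hkf' : k ≠ f := by
        rintro rfl
        exact hfe (by rw [← hk.1, hbot k hf])
      have hkg' : k ≠ g := by
        rintro rfl
        exact hke (by rw [← hk.2.1, hge])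
      exact hnot e k hke.symm he hfe.symm hkf' hkg' hge hgk hfk hkf hkg
        (Or.inl ⟨hk.1, hk.2.1, hkk⟩) (hbot f hf) (hbot' f hf)
    have hgeu : IsUnitAt e (g * e) := hg.mul_idem h he (hbot' f hf)
    refine Or.inr (Or.inr (Or.inr (Or.inr (Or.inl
      (nonempty_mulEquiv_linSemilattice_two_prod hgf.symm hge.symm (fun x => ?_)
        (h.idem_central he) he (hbot f hf) hfe.symm hf hg.1 hg.2.1 hgg)))))
    rcases hx x with hxe | hxf | hxg
    · by_cases hxe' : x = e
      · exact Or.inl hxe'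
      · exact Or.inr (Or.inl (hbelow x _ hxe hgeu hxe' hge))
    · exact Or.inr (Or.inr (Or.inl hxf))
    · exact Or.inr (Or.inr (Or.inr hxg))
  · push Not at hunit
    have hge : g * e = e := hunit _ (hg.mul_idem h he (hbot' f hf))
    exact Or.inr (Or.inr (Or.inr (Or.inr (Or.inr (Or.inl
      (nonempty_mulEquiv_one_orderedUnion hgf.symm hfe.symm (hgid e he)
        (fun x => (hx x).imp_left (hunit x)) he hf hg.1 hg.2.1 hgg ⟨hbot f hf, hbot' f hf⟩
        ⟨by rw [h.idem_central he, hge], hge⟩))))))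

end Classification

theorem theorem1p1 (X : Type*) [Semigroup X] :
    List.TFAE [
      (∀ F G : superextension X, F * G = G * F) ∧ IsCliffordSemigroup (superextension X),
      IsInverseSemigroup (superextension X),
      IdempotentsCommute (superextension X) ∧
        (IsSubCliffordSemigroup (superextension X) ∨
          IsRegularIn (superextension X) (linkedUpfamilies X)),
      Finite X ∧ (∀ x y : X, x * y = y * x) ∧ IsCliffordSemigroup X ∧
        (Nonempty (X ≃* CyclicGrp 2) ∨
          Nonempty (X ≃* CyclicGrp 3) ∨
          Nonempty (X ≃* CyclicGrp 4) ∨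
          Nonempty (X ≃* CyclicGrp 2 × CyclicGrp 2) ∨
          Nonempty (X ≃* LinSemilattice 2 × CyclicGrp 2) ∨
          Nonempty (X ≃* OrderedUnion (LinSemilattice 1) (CyclicGrp 2)) ∨
          (∃ n : ℕ, Nonempty (X ≃* LinSemilattice n)) ∨
          ∃ n : ℕ, Nonempty (X ≃* OrderedUnion (CyclicGrp 2) (LinSemilattice n)))] := by
  tfae_have 1 → 2 := fun ⟨hc, h⟩ => h.isInverseSemigroup hc
  tfae_have 2 → 3 := fun h => by
    refine ⟨h.idempotentsCommute, Or.inr fun F hF => ?_⟩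
    obtain ⟨G, ⟨hG, -⟩, -⟩ := h ⟨F, hF⟩
    exact ⟨G.1, G.2.1, congrArg Subtype.val hG⟩
  tfae_have 3 → 4 := fun ⟨hI, hR⟩ => by
    have hchain := isCliffordChain hI hR
    have hfin := finite_of_idempotentsCommute hI hchain
    have hreg : ∀ F : Upfamily X, F.IsMaximalLinked → F.IsLinkedRegular := fun F hF =>
      hF.isLinkedRegular hR (K := ⊤) (Set.toFinite _) trivial
    have hX := isExceptional_of_isCliffordChain hI hreg hchain
    -- Commutativity of X is read off from that of λ(X) through principal upfamilies.
    refine ⟨hfin, hX.commRegularSuperextension.mul_comm, fun x => ?_, hX⟩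
    obtain ⟨y, h1, -, h2⟩ := hchain.exists_inv x
    exact exists_isGroupSubsemigroup h1 h2
  tfae_have 4 → 1 := fun ⟨_, _, _, hX⟩ =>
    ⟨(IsExceptional.commRegularSuperextension hX).commutative,
      (IsExceptional.commRegularSuperextension hX).isCliffordSemigroup⟩
  tfae_finish
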